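/- Let $G$ be a $3$-graph, that is, a finite vertex set $V$ together with a set $E(G)$ of $3$-element subsets of $V$ (the edges). For a weighting $x=(x_v)_{v\in V}$ in the simplex $S_V=\{x\in\mathbb{R}^V : x_v\ge 0 \text{ for all } v,\ \sum_{v\in V}x_v=1\}$ put $\lambda(G,x)=\sum_{\{u,v,w\}\in E(G)}x_ux_vx_w$, and let $\lambda(G)=\max_{x\in S_V}\lambda(G,x)$ be the Lagrangian of $G$. Let $[t]^{(3)}$ denote the complete $3$-graph on the vertex set $\{1,\dots,t\}$; a clique of order $t$ in $G$ is a set of $t$ vertices of $G$ all of whose $3$-element subsets are edges of $G$. Let $l$ and $m$ be integers with $6\le l\le 13$ and $\binom{l-1}{3}\le m\le\binom{l-1}{3}+\binom{l-2}{2}$. If $G$ is a $3$-graph with exactly $m$ edges that contains no clique of order $l-1$, then $$\lambda(G)<\lambda([l-1]^{(3)}).$$ -/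

import Mathlib

/-- An `r`-uniform graph with vertex set `V`: a set of `r`-element subsets of `V`. -/
structure UniformGraph (V : Type*) (r : ℕ) where
  /-- The edge set. -/
  edges : Finset (Finset V)
  /-- Every edge has exactly `r` vertices. -/
  card_edge : ∀ e ∈ edges, e.card = r

namespace UniformGraph

variable {V : Type*} {r : ℕ}

/-- The complete `r`-graph on the vertex set `V`. -/
def complete (V : Type*) [Fintype V] (r : ℕ) : UniformGraph V r where
  edges := Finset.powersetCard r Finset.univ
  card_edge := fun _ he => (Finset.mem_powersetCard.mp he).2

/-- `G` contains a clique of order `t`: some `t` vertices all of whose `r`-subsets are edges. -/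
def ContainsClique (G : UniformGraph V r) (t : ℕ) : Prop :=
  ∃ S : Finset V, S.card = t ∧ ∀ e : Finset V, e ⊆ S → e.card = r → e ∈ G.edges

/-- The value `λ(G, x) = ∑_{e ∈ E(G)} ∏_{i ∈ e} x i`. -/
def lagrangianAt (G : UniformGraph V r) (x : V → ℝ) : ℝ :=
  ∑ e ∈ G.edges, ∏ i ∈ e, x i

/-- The Lagrangian `λ(G)`, the maximum of `λ(G, x)` over the standard simplex
(nonnegative weightings of total weight one). -/
noncomputable def lagrangian [Fintype V] (G : UniformGraph V r) : ℝ :=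
  sSup (G.lagrangianAt '' stdSimplex ℝ V)

/-- The supremum defining the Lagrangian is a maximum as soon as there is a vertex. -/
theorem isGreatest_lagrangian [Fintype V] [Nonempty V] (G : UniformGraph V r) :
    IsGreatest (G.lagrangianAt '' stdSimplex ℝ V) G.lagrangian := by
  classical
  have hc : Continuous G.lagrangianAt := by
    unfold lagrangianAt
    fun_prop
  have hne : (stdSimplex ℝ V).Nonempty :=
    ⟨_, single_mem_stdSimplex ℝ (Classical.arbitrary V)⟩
  exact ((isCompact_stdSimplex ℝ V).image hc).isGreatest_sSup (hne.image _)

end UniformGraph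

/-! Put `r = l - 4` and `L = (r+2)(r+1)/(r+3)^2`, six times the Lagrangian of the complete 3-graph
on `r + 3` vertices. The bound on the number of edges is the size of the twin graph: all triples of
`r + 4` vertices except those containing both of the last two. Splitting one vertex of the clique
into two such twins leaves the Lagrangian unchanged, so the value `L` is attained, and the task is
to show that every pair reaching it contains the clique.

Fix a family `E` and a weighting `x` that jointly maximise the weight sum, and suppose six times
that value is at least `L`. Sort `x` decreasingly, replace `E` by a compressed family of equal value
and restrict to the support, of size `k`.

If `k ≤ r + 3`, the cubic symmetric sum is maximal only at the uniform weighting, so no triple can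
be absent. If `k ≥ r + 5`, merging the last vertex into its neighbour costs little and frees its
edges for absent twin triples; optimality forces the weights from index `r` on to be so small that
the derivative at vertex `0` falls below `L` (`IsOptimal.false_of_large_support`).

If `k = r + 4`, the main point is that no edge contains both last vertices
(`IsOptimal.not_covered`). When the first `r + 3` vertices form a clique, two first-order conditions
clash. Otherwise the loss from merging is weighed against the deficit of the merged weighting from
the clique optimum and against the absent triples, and an inequality in five weights (`twin_arith`)
refutes it. Without such edges merging is free, so the merged weighting is uniform, and the
original, uncompressed family must contain the twin graph, hence the clique.

Thus the joint optimum, once it reaches `L`, equals `L`. Any pair reaching `L` is then itself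
optimal, so its family contains the clique. -/

open Finset

/-! ### Weight polynomials and their expansion along vertices -/

namespace TripleSystem

/-- The polynomial `∑_{e ∈ E} ∏_{i ∈ e} x i` of a family `E` of finite sets of naturals. -/
def weightSum (E : Finset (Finset ℕ)) (x : ℕ → ℝ) : ℝ := ∑ e ∈ E, ∏ i ∈ e, x i

/-- The elementary symmetric sum of degree `r` over `s`. -/
def esum (s : Finset ℕ) (x : ℕ → ℝ) (r : ℕ) : ℝ := ∑ p ∈ powersetCard r s, ∏ i ∈ p, x i

/-- The weight of the `r`-subsets `p` of `s` for which `t ∪ p` belongs to `E`. -/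
def linkSum (E : Finset (Finset ℕ)) (s : Finset ℕ) (x : ℕ → ℝ) (t : Finset ℕ) (r : ℕ) : ℝ :=
  ∑ p ∈ powersetCard r s, if t ∪ p ∈ E then ∏ i ∈ p, x i else 0

/-- The weight of the `r`-subsets `p` of `s` for which `t ∪ p` does not belong to `E`. -/
def missSum (E : Finset (Finset ℕ)) (s : Finset ℕ) (x : ℕ → ℝ) (t : Finset ℕ) (r : ℕ) : ℝ :=
  ∑ p ∈ powersetCard r s, if t ∪ p ∈ E then 0 else ∏ i ∈ p, x i

theorem sum_powersetCard_insert {a : ℕ} {s : Finset ℕ} (ha : a ∉ s) (r : ℕ) (g : Finset ℕ → ℝ) :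
    ∑ e ∈ powersetCard (r + 1) (insert a s), g e =
      ∑ e ∈ powersetCard (r + 1) s, g e + ∑ p ∈ powersetCard r s, g (insert a p) := by
  rw [powersetCard_succ_insert ha, sum_union, sum_image]
  · intro p hp q hq h
    have hp' : a ∉ p := fun h' => ha ((mem_powersetCard.1 hp).1 h')
    have hq' : a ∉ q := fun h' => ha ((mem_powersetCard.1 hq).1 h')
    rw [← erase_insert hp', ← erase_insert hq', h]
  · rw [disjoint_left]
    intro e he he'
    obtain ⟨p, -, rfl⟩ := mem_image.1 he'
    exact ha ((mem_powersetCard.1 he).1 (mem_insert_self a p))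

theorem linkSum_insert {E : Finset (Finset ℕ)} {a : ℕ} {s : Finset ℕ} (ha : a ∉ s) (x : ℕ → ℝ)
    (t : Finset ℕ) (r : ℕ) :
    linkSum E (insert a s) x t (r + 1) =
      linkSum E s x t (r + 1) + x a * linkSum E s x (insert a t) r := by
  unfold linkSum
  rw [sum_powersetCard_insert ha, mul_sum]
  congr 1
  refine sum_congr rfl fun p hp => ?_
  have hp' : a ∉ p := fun h' => ha ((mem_powersetCard.1 hp).1 h')
  rw [prod_insert hp', union_insert, insert_union]
  split_ifs <;> simp

theorem missSum_insert {E : Finset (Finset ℕ)} {a : ℕ} {s : Finset ℕ} (ha : a ∉ s) (x : ℕ → ℝ)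
    (t : Finset ℕ) (r : ℕ) :
    missSum E (insert a s) x t (r + 1) =
      missSum E s x t (r + 1) + x a * missSum E s x (insert a t) r := by
  unfold missSum
  rw [sum_powersetCard_insert ha, mul_sum]
  congr 1
  refine sum_congr rfl fun p hp => ?_
  have hp' : a ∉ p := fun h' => ha ((mem_powersetCard.1 hp).1 h')
  rw [prod_insert hp', union_insert, insert_union]
  split_ifs <;> simp

theorem esum_insert {a : ℕ} {s : Finset ℕ} (ha : a ∉ s) (x : ℕ → ℝ) (r : ℕ) :
    esum (insert a s) x (r + 1) = esum s x (r + 1) + x a * esum s x r := by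
  unfold esum
  rw [sum_powersetCard_insert ha, mul_sum]
  congr 1
  refine sum_congr rfl fun p hp => ?_
  rw [prod_insert fun h' => ha ((mem_powersetCard.1 hp).1 h')]

theorem linkSum_add_missSum (E : Finset (Finset ℕ)) (s : Finset ℕ) (x : ℕ → ℝ) (t : Finset ℕ)
    (r : ℕ) : linkSum E s x t r + missSum E s x t r = esum s x r := by
  unfold linkSum missSum esum
  rw [← sum_add_distrib]
  refine sum_congr rfl fun p _ => ?_
  split_ifs <;> simp

theorem linkSum_congr {E : Finset (Finset ℕ)} {s : Finset ℕ} {x x' : ℕ → ℝ}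
    (h : ∀ i ∈ s, x i = x' i) (t : Finset ℕ) (r : ℕ) :
    linkSum E s x t r = linkSum E s x' t r := by
  refine sum_congr rfl fun p hp => ?_
  rw [prod_congr rfl fun i hi => h i ((mem_powersetCard.1 hp).1 hi)]

theorem missSum_congr {E : Finset (Finset ℕ)} {s : Finset ℕ} {x x' : ℕ → ℝ}
    (h : ∀ i ∈ s, x i = x' i) (t : Finset ℕ) (r : ℕ) :
    missSum E s x t r = missSum E s x' t r := by
  refine sum_congr rfl fun p hp => ?_
  rw [prod_congr rfl fun i hi => h i ((mem_powersetCard.1 hp).1 hi)]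

theorem linkSum_nonneg (E : Finset (Finset ℕ)) (s : Finset ℕ) {x : ℕ → ℝ} (hx : ∀ i, 0 ≤ x i)
    (t : Finset ℕ) (r : ℕ) : 0 ≤ linkSum E s x t r := by
  refine sum_nonneg fun p _ => ?_
  split_ifs
  exacts [prod_nonneg fun i _ => hx i, le_rfl]

theorem missSum_nonneg (E : Finset (Finset ℕ)) (s : Finset ℕ) {x : ℕ → ℝ} (hx : ∀ i, 0 ≤ x i)
    (t : Finset ℕ) (r : ℕ) : 0 ≤ missSum E s x t r := by
  refine sum_nonneg fun p _ => ?_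
  split_ifs
  exacts [le_rfl, prod_nonneg fun i _ => hx i]

theorem linkSum_le_esum (E : Finset (Finset ℕ)) (s : Finset ℕ) {x : ℕ → ℝ} (hx : ∀ i, 0 ≤ x i)
    (t : Finset ℕ) (r : ℕ) : linkSum E s x t r ≤ esum s x r := by
  linarith [linkSum_add_missSum E s x t r, missSum_nonneg E s hx t r]

theorem missSum_le_esum (E : Finset (Finset ℕ)) (s : Finset ℕ) {x : ℕ → ℝ} (hx : ∀ i, 0 ≤ x i)
    (t : Finset ℕ) (r : ℕ) : missSum E s x t r ≤ esum s x r := by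
  linarith [linkSum_add_missSum E s x t r, linkSum_nonneg E s hx t r]

theorem weightSum_eq_linkSum {E : Finset (Finset ℕ)} {U : Finset ℕ} {r : ℕ}
    (hE : E ⊆ powersetCard r U) (x : ℕ → ℝ) : weightSum E x = linkSum E U x ∅ r := by
  unfold weightSum linkSum
  simp only [empty_union]
  rw [← sum_filter, filter_mem_eq_inter, inter_eq_right.2 hE]

theorem esum_one (s : Finset ℕ) (x : ℕ → ℝ) : esum s x 1 = ∑ i ∈ s, x i := by
  simp [esum, powersetCard_one]

theorem two_mul_esum_two (s : Finset ℕ) (x : ℕ → ℝ) :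
    2 * esum s x 2 = (∑ i ∈ s, x i) ^ 2 - ∑ i ∈ s, x i ^ 2 := by
  induction s using Finset.induction_on with
  | empty => simp [esum, show powersetCard 2 (∅ : Finset ℕ) = ∅ by decide]
  | insert a s ha ih =>
    rw [esum_insert ha, esum_one, sum_insert ha, sum_insert ha]
    linear_combination ih

theorem six_mul_esum_three (s : Finset ℕ) (x : ℕ → ℝ) :
    6 * esum s x 3 =
      (∑ i ∈ s, x i) ^ 3 - 3 * (∑ i ∈ s, x i) * ∑ i ∈ s, x i ^ 2 + 2 * ∑ i ∈ s, x i ^ 3 := by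
  induction s using Finset.induction_on with
  | empty => simp [esum, show powersetCard 3 (∅ : Finset ℕ) = ∅ by decide]
  | insert a s ha ih =>
    rw [esum_insert ha, sum_insert ha, sum_insert ha, sum_insert ha]
    linear_combination ih + 3 * x a * two_mul_esum_two s x

/-- Value of the cubic symmetric sum relative to its maximum on an `n`-point simplex. -/
theorem esum_three_eq {s : Finset ℕ} {x : ℕ → ℝ} {n : ℝ} (hn : n ≠ 0) (hs : (s.card : ℝ) = n)
    (hx : ∑ i ∈ s, x i = 1) :
    6 * esum s x 3 = (n - 1) * (n - 2) / n ^ 2 -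
      ∑ i ∈ s, (x i - 1 / n) ^ 2 * (3 - 4 / n - 2 * x i) := by
  -- On the simplex, `6 * esum s x 3 = 1 - ∑ (3t² - 2t³)` with `t = x i`. Each summand here is the
  -- remainder of `3t² - 2t³` after subtracting its tangent line at `1 / n`.
  have h : ∑ i ∈ s, (x i - 1 / n) ^ 2 * (3 - 4 / n - 2 * x i) =
      3 * ∑ i ∈ s, x i ^ 2 - 2 * ∑ i ∈ s, x i ^ 3 - (6 / n - 6 / n ^ 2) * ∑ i ∈ s, x i +
        s.card * (3 / n ^ 2 - 4 / n ^ 3) := by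
    rw [← nsmul_eq_mul, ← sum_const, mul_sum, mul_sum, mul_sum, ← sum_sub_distrib,
      ← sum_sub_distrib, ← sum_add_distrib]
    refine sum_congr rfl fun i _ => ?_
    field_simp
    ring
  rw [six_mul_esum_three, h, hx, hs]
  field_simp
  ring

/-- Splitting of the weight sum along two vertices. -/
theorem weightSum_split {E : Finset (Finset ℕ)} {s : Finset ℕ} {i j : ℕ} (hi : i ∉ s) (hj : j ∉ s)
    (hij : i ≠ j) (hE : E ⊆ powersetCard 3 (insert j (insert i s))) (x : ℕ → ℝ) :
    weightSum E x = linkSum E s x ∅ 3 + x i * linkSum E s x {i} 2 + x j * linkSum E s x {j} 2 +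
      x i * x j * linkSum E s x {i, j} 1 := by
  have hj' : j ∉ insert i s := by simp [hj, hij.symm]
  rw [weightSum_eq_linkSum hE, linkSum_insert hj', linkSum_insert hi, linkSum_insert hi]
  simp only [insert_empty_eq]
  ring

/-! ### Optimal pairs and first-order conditions -/

/-- Feasible pairs: at most `M` triples in `range N` and a point of the simplex on `range N`. -/
structure Feasible (N M : ℕ) (E : Finset (Finset ℕ)) (x : ℕ → ℝ) : Prop where
  edges : E ⊆ powersetCard 3 (range N)
  card_le : E.card ≤ M
  nonneg : ∀ i, 0 ≤ x i
  zero : ∀ i, N ≤ i → x i = 0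
  sum_eq : ∑ i ∈ range N, x i = 1

/-- Feasible pairs of largest weight sum. -/
structure IsOptimal (N M : ℕ) (E : Finset (Finset ℕ)) (x : ℕ → ℝ) : Prop
    extends Feasible N M E x where
  max : ∀ E' x', Feasible N M E' x' → weightSum E' x' ≤ weightSum E x

/-- Redistribution of weight to the two vertices `i` and `j`. -/
def move (x : ℕ → ℝ) (i j : ℕ) (u v : ℝ) : ℕ → ℝ :=
  Function.update (Function.update x i u) j v

theorem move_right (x : ℕ → ℝ) (i j : ℕ) (u v : ℝ) : move x i j u v j = v := by simp [move]

theorem move_left (x : ℕ → ℝ) {i j : ℕ} (hij : i ≠ j) (u v : ℝ) : move x i j u v i = u := by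
  simp [move, hij]

theorem move_of_ne (x : ℕ → ℝ) {i j l : ℕ} (hi : l ≠ i) (hj : l ≠ j) (u v : ℝ) :
    move x i j u v l = x l := by
  simp [move, hi, hj]

theorem insert_insert_erase {U : Finset ℕ} {i j : ℕ} (hi : i ∈ U) (hj : j ∈ U) (hij : i ≠ j) :
    insert j (insert i ((U.erase i).erase j)) = U := by
  rw [insert_comm, insert_erase (mem_erase.2 ⟨hij.symm, hj⟩), insert_erase hi]

variable {N M : ℕ} {E : Finset (Finset ℕ)} {x : ℕ → ℝ}

theorem Feasible.move (h : Feasible N M E x) {i j : ℕ} (hi : i < N) (hj : j < N) (hij : i ≠ j)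
    {u v : ℝ} (hu : 0 ≤ u) (hv : 0 ≤ v) (huv : u + v = x i + x j) :
    Feasible N M E (move x i j u v) where
  edges := h.edges
  card_le := h.card_le
  nonneg l := by
    rcases eq_or_ne l j with rfl | hlj
    · rwa [move_right]
    rcases eq_or_ne l i with rfl | hli
    · rwa [move_left _ hij]
    rw [move_of_ne _ hli hlj]; exact h.nonneg l
  zero l hl := by rw [move_of_ne _ (by omega) (by omega)]; exact h.zero l hl
  sum_eq := by
    have h1 := h.sum_eq
    rw [← insert_insert_erase (mem_range.2 hi) (mem_range.2 hj) hij, sum_insert (by simp [hij.symm]),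
      sum_insert (by simp [hij])] at h1 ⊢
    rw [move_right, move_left _ hij, ← h1, sum_congr rfl fun l hl => ?_]
    · linarith
    · simp only [mem_erase] at hl
      exact move_of_ne _ hl.2.1 hl.1 _ _

theorem weightSum_move {U : Finset ℕ} (hE : E ⊆ powersetCard 3 U) {i j : ℕ} (hi : i ∈ U)
    (hj : j ∈ U) (hij : i ≠ j) (u v : ℝ) :
    weightSum E (move x i j u v) = linkSum E ((U.erase i).erase j) x ∅ 3 +
      u * linkSum E ((U.erase i).erase j) x {i} 2 + v * linkSum E ((U.erase i).erase j) x {j} 2 +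
      u * v * linkSum E ((U.erase i).erase j) x {i, j} 1 := by
  have hE' := hE
  rw [← insert_insert_erase hi hj hij] at hE'
  have hc : ∀ l ∈ (U.erase i).erase j, TripleSystem.move x i j u v l = x l := fun l hl => by
    simp only [mem_erase] at hl
    exact move_of_ne _ hl.2.1 hl.1 _ _
  rw [weightSum_split (by simp) (by simp) hij hE', move_right, move_left _ hij]
  simp only [linkSum_congr hc]

/-- An interior maximum has zero derivative. The step `|α| / (2 * (|C| + 1))`, truncated to the
allowed interval, is short enough for the linear term to dominate the quadratic one. -/
theorem eq_zero_of_quadratic_nonpos {p q α C : ℝ} (hp : 0 < p) (hq : 0 < q)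
    (h : ∀ t, -p ≤ t → t ≤ q → t * α - t ^ 2 * C ≤ 0) : α = 0 := by
  by_contra hα
  have hD : 0 < |C| + 1 := by positivity
  rcases lt_or_gt_of_ne hα with hα | hα
  · set t := min p (-α / (2 * (|C| + 1))) with ht
    have h0 : 0 < t := lt_min hp (div_pos (by linarith) (by positivity))
    have h1 := h (-t) (by linarith [min_le_left p (-α / (2 * (|C| + 1)))]) (by linarith)
    have h2 : t * (2 * (|C| + 1)) ≤ -α := (le_div_iff₀ (by positivity)).1 (min_le_right _ _)
    have h3 : -t * (-α) + t ^ 2 * C ≥ 0 → False := fun h' => by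
      have h4 : C ≤ |C| := le_abs_self C
      nlinarith [mul_pos h0 h0]
    apply h3
    nlinarith
  · set t := min q (α / (2 * (|C| + 1))) with ht
    have h0 : 0 < t := lt_min hq (div_pos (by linarith) (by positivity))
    have h1 := h t (by linarith) (min_le_left _ _)
    have h2 : t * (2 * (|C| + 1)) ≤ α := (le_div_iff₀ (by positivity)).1 (min_le_right _ _)
    have h4 : C ≤ |C| := le_abs_self C
    nlinarith [mul_pos h0 h0]

/-- First order condition for two vertices of positive weight. -/
theorem IsOptimal.link_eq (h : IsOptimal N M E x) {i j : ℕ} (hi : i < N) (hj : j < N)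
    (hij : i ≠ j) (hxi : 0 < x i) (hxj : 0 < x j) :
    linkSum E (((range N).erase i).erase j) x {i} 2 +
        x j * linkSum E (((range N).erase i).erase j) x {i, j} 1 =
      linkSum E (((range N).erase i).erase j) x {j} 2 +
        x i * linkSum E (((range N).erase i).erase j) x {i, j} 1 := by
  set A := linkSum E (((range N).erase i).erase j) x {i} 2
  set B := linkSum E (((range N).erase i).erase j) x {j} 2
  set C := linkSum E (((range N).erase i).erase j) x {i, j} 1
  have key := eq_zero_of_quadratic_nonpos (α := A + x j * C - (B + x i * C)) (C := C) hxi hxj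
    fun t ht1 ht2 => by
      have h1 := h.max E _ (h.toFeasible.move hi hj hij (u := x i + t) (v := x j - t)
        (by linarith) (by linarith) (by ring))
      rw [weightSum_move h.edges (mem_range.2 hi) (mem_range.2 hj) hij] at h1
      have h2 := h.edges
      rw [← insert_insert_erase (mem_range.2 hi) (mem_range.2 hj) hij] at h2
      rw [weightSum_split (by simp) (by simp) hij h2 x] at h1
      nlinarith
  linarith

/-- The partial derivatives at two vertices of positive weight agree. -/
theorem IsOptimal.deriv_eq (h : IsOptimal N M E x) {i j : ℕ} (hi : i < N) (hj : j < N)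
    (hxi : 0 < x i) (hxj : 0 < x j) :
    linkSum E ((range N).erase i) x {i} 2 = linkSum E ((range N).erase j) x {j} 2 := by
  rcases eq_or_ne i j with rfl | hij
  · rfl
  have h1 : insert j (((range N).erase i).erase j) = (range N).erase i :=
    insert_erase (by simp [hj, hij.symm])
  have h2 : insert i (((range N).erase i).erase j) = (range N).erase j := by
    rw [erase_right_comm]
    exact insert_erase (by simp [hi, hij])
  rw [← h1, linkSum_insert (by simp), ← h2, linkSum_insert (by simp)]
  have h3 := h.link_eq hi hj hij hxi hxj
  rw [pair_comm j i]
  exact h3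

theorem mul_linkSum_eq {U : Finset ℕ} (hE : E ⊆ powersetCard 3 U) {i : ℕ} (hi : i ∈ U)
    (x : ℕ → ℝ) :
    x i * linkSum E (U.erase i) x {i} 2 = ∑ e ∈ E with i ∈ e, ∏ l ∈ e, x l := by
  have h1 : weightSum E x = linkSum E (U.erase i) x ∅ 3 +
      x i * linkSum E (U.erase i) x {i} 2 := by
    rw [weightSum_eq_linkSum hE, ← insert_erase hi, linkSum_insert (by simp), erase_insert (by simp)]
    simp
  have h2 : linkSum E (U.erase i) x ∅ 3 = ∑ e ∈ E with i ∉ e, ∏ l ∈ e, x l := by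
    unfold linkSum
    rw [← sum_filter]
    refine sum_congr ?_ fun _ _ => rfl
    ext e
    simp only [mem_filter, mem_powersetCard, empty_union, subset_erase]
    constructor
    · rintro ⟨⟨⟨-, h⟩, -⟩, h'⟩
      exact ⟨h', h⟩
    · rintro ⟨h, h'⟩
      exact ⟨⟨⟨(mem_powersetCard.1 (hE h)).1, h'⟩, (mem_powersetCard.1 (hE h)).2⟩, h⟩
  have h3 := sum_filter_add_sum_filter_not E (fun e => i ∈ e) (fun e => ∏ l ∈ e, x l)
  unfold weightSum at h1
  linarith

/-- Euler's identity for a cubic form: each edge is counted once for each of its three vertices. -/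
theorem sum_mul_linkSum {U : Finset ℕ} (hE : E ⊆ powersetCard 3 U) (x : ℕ → ℝ) :
    ∑ i ∈ U, x i * linkSum E (U.erase i) x {i} 2 = 3 * weightSum E x := by
  rw [sum_congr rfl fun i hi => mul_linkSum_eq hE hi x]
  simp only [sum_filter]
  rw [sum_comm, weightSum, mul_sum]
  refine sum_congr rfl fun e he => ?_
  obtain ⟨h1, h2⟩ := mem_powersetCard.1 (hE he)
  rw [← sum_filter, filter_mem_eq_inter, inter_eq_right.2 h1, sum_const, h2]
  simp

/-- All partial derivatives share one value, and averaging them with the weights `x i` identifies it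
through Euler's identity. -/
theorem IsOptimal.deriv_eq_three_mul (h : IsOptimal N M E x) (hpos : ∀ i < N, 0 < x i) {i : ℕ}
    (hi : i < N) : linkSum E ((range N).erase i) x {i} 2 = 3 * weightSum E x := by
  rw [← sum_mul_linkSum h.edges, sum_congr rfl fun j hj => by
    rw [h.deriv_eq (mem_range.1 hj) hi (hpos j (mem_range.1 hj)) (hpos i hi)], ← sum_mul,
    h.sum_eq, one_mul]

end TripleSystem

/-! ### Compression and the twin graph -/

namespace TripleSystem

variable {N M : ℕ} {E : Finset (Finset ℕ)} {x : ℕ → ℝ}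

theorem exists_sorted_pair {e : Finset ℕ} (h : e.card = 2) : ∃ a b, a < b ∧ e = {a, b} := by
  obtain ⟨a, b, hab, rfl⟩ := card_eq_two.1 h
  rcases lt_or_gt_of_ne hab with h | h
  · exact ⟨a, b, h, rfl⟩
  · exact ⟨b, a, h, pair_comm a b⟩

theorem exists_sorted_triple {e : Finset ℕ} (h : e.card = 3) :
    ∃ a b c, a < b ∧ b < c ∧ e = {a, b, c} := by
  have hne : e.Nonempty := card_pos.1 (by omega)
  have h2 : (e.erase (e.min' hne)).card = 2 := by rw [card_erase_of_mem (min'_mem _ _), h]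
  obtain ⟨b, c, hbc, hE⟩ := exists_sorted_pair h2
  refine ⟨e.min' hne, b, c, ?_, hbc, ?_⟩
  · exact min'_lt_of_mem_erase_min' _ hne (by rw [hE]; simp)
  · rw [← hE, insert_erase (min'_mem _ _)]

theorem prod_triple (x : ℕ → ℝ) {a b c : ℕ} (hab : a < b) (hbc : b < c) :
    ∏ i ∈ ({a, b, c} : Finset ℕ), x i = x a * x b * x c := by
  rw [prod_insert (by simp; omega), prod_pair (by omega), mul_assoc]

theorem prod_triple_le (hx : Antitone x) (h0 : ∀ i, 0 ≤ x i) {a b c a' b' c' : ℕ}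
    (ha : a ≤ a') (hb : b ≤ b') (hc : c ≤ c') :
    x a' * x b' * x c' ≤ x a * x b * x c := by
  have := h0 a'; have := h0 b'; have := h0 c'; have := h0 a; have := h0 b
  exact mul_le_mul (mul_le_mul (hx ha) (hx hb) (h0 _) (h0 _)) (hx hc) (h0 _) (by positivity)

/-- A family is compressed when replacing a vertex of a member by a smaller one stays inside. -/
def Compressed (E : Finset (Finset ℕ)) : Prop :=
  ∀ e ∈ E, ∀ j ∈ e, ∀ i < j, i ∉ e → insert i (e.erase j) ∈ E

/-- Lower the three entries one at a time, smallest first, so that the new entry never collides with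
a remaining one. -/
theorem Compressed.mono_triple (hE : Compressed E) {a b c a' b' c' : ℕ} (hab : a < b) (hbc : b < c)
    (hab' : a' < b') (hbc' : b' < c') (ha : a ≤ a') (hb : b ≤ b') (hc : c ≤ c')
    (h : ({a', b', c'} : Finset ℕ) ∈ E) : ({a, b, c} : Finset ℕ) ∈ E := by
  have h1 : ({a, b', c'} : Finset ℕ) ∈ E := by
    rcases ha.eq_or_lt with rfl | ha
    · exact h
    have := hE _ h a' (by simp) a ha (by simp; omega)
    rwa [erase_insert (by simp; omega)] at this
  have h2 : ({a, b, c'} : Finset ℕ) ∈ E := by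
    rcases hb.eq_or_lt with rfl | hb
    · exact h1
    have := hE _ h1 b' (by simp) b hb (by simp; omega)
    convert this using 1
    ext i
    simp only [mem_insert, mem_singleton, mem_erase]
    omega
  rcases hc.eq_or_lt with rfl | hc
  · exact h2
  have := hE _ h2 c' (by simp) c hc (by simp; omega)
  convert this using 1
  ext i
  simp only [mem_insert, mem_singleton, mem_erase]
  omega

theorem Compressed.filter_range (hE : Compressed E) (k : ℕ) :
    Compressed {e ∈ E | e ⊆ range k} := by
  intro e he j hj i hij hi
  obtain ⟨he, hk⟩ := mem_filter.1 he
  refine mem_filter.2 ⟨hE e he j hj i hij hi, insert_subset ?_ ((erase_subset _ _).trans hk)⟩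
  have := mem_range.1 (hk hj)
  exact mem_range.2 (by omega)

/-- Replacing an edge by a non-edge. -/
theorem weightSum_exchange {e f : Finset ℕ} (he : e ∈ E) (hf : f ∉ E) (x : ℕ → ℝ) :
    weightSum (insert f (E.erase e)) x = weightSum E x - ∏ i ∈ e, x i + ∏ i ∈ f, x i := by
  unfold weightSum
  rw [sum_insert (fun h => hf (mem_of_mem_erase h)), ← sum_erase_add E _ he]
  ring

theorem Feasible.exchange (h : Feasible N M E x) {e f : Finset ℕ} (he : e ∈ E) (hf : f ∉ E)
    (hfN : f ∈ powersetCard 3 (range N)) : Feasible N M (insert f (E.erase e)) x where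
  edges := insert_subset hfN ((erase_subset _ _).trans h.edges)
  card_le := by
    rw [card_insert_of_notMem (fun h => hf (mem_of_mem_erase h)), card_erase_add_one he]
    exact h.card_le
  nonneg := h.nonneg
  zero := h.zero
  sum_eq := h.sum_eq

theorem IsOptimal.exchange_le (h : IsOptimal N M E x) {e f : Finset ℕ} (he : e ∈ E) (hf : f ∉ E)
    (hfN : f ∈ powersetCard 3 (range N)) : ∏ i ∈ f, x i ≤ ∏ i ∈ e, x i := by
  have := h.max _ _ (h.toFeasible.exchange he hf hfN)
  rw [weightSum_exchange he hf] at this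
  linarith

/-- For decreasing weights a shift to a smaller vertex never lowers the weight sum, so it preserves
optimality. It lowers the total of all labels, so shifting terminates. -/
theorem IsOptimal.exists_compressed (h : IsOptimal N M E x) (hx : Antitone x) :
    ∃ E', IsOptimal N M E' x ∧ Compressed E' ∧ weightSum E' x = weightSum E x := by
  induction hw : ∑ e ∈ E, ∑ i ∈ e, i using Nat.strong_induction_on generalizing E with
  | _ w ih =>
    by_cases hc : Compressed E
    · exact ⟨E, h, hc, rfl⟩
    simp only [Compressed, not_forall] at hc
    obtain ⟨e, he, j, hj, i, hij, hi, hf⟩ := hc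
    have heN := mem_powersetCard.1 (h.edges he)
    have hi' : i ∉ e.erase j := fun h => hi (mem_of_mem_erase h)
    have hfN : insert i (e.erase j) ∈ powersetCard 3 (range N) := by
      refine mem_powersetCard.2 ⟨insert_subset ?_ ((erase_subset _ _).trans heN.1), ?_⟩
      · have := mem_range.1 (heN.1 hj)
        exact mem_range.2 (by omega)
      · rw [card_insert_of_notMem hi', card_erase_add_one hj, heN.2]
    have hprod : ∏ l ∈ e, x l ≤ ∏ l ∈ insert i (e.erase j), x l := by
      rw [prod_insert hi', ← mul_prod_erase e x hj]
      exact mul_le_mul_of_nonneg_right (hx hij.le) (prod_nonneg fun l _ => h.nonneg l)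
    have hws := weightSum_exchange he hf x
    have hF := h.toFeasible.exchange he hf hfN
    have heq : weightSum (insert (insert i (e.erase j)) (E.erase e)) x = weightSum E x :=
      le_antisymm (h.max _ _ hF) (by linarith)
    have hopt : IsOptimal N M (insert (insert i (e.erase j)) (E.erase e)) x :=
      ⟨hF, fun E' x' h' => heq ▸ h.max E' x' h'⟩
    obtain ⟨E', h1, h2, h3⟩ := ih _ (by
      rw [← hw, sum_insert (fun h => hf (mem_of_mem_erase h)), ← sum_erase_add E _ he,
        sum_insert hi', ← sum_erase_add e _ hj]
      omega) hopt rfl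
    exact ⟨E', h1, h2, h3.trans heq⟩

theorem weightSum_filter_of_zero {k : ℕ} (hz : ∀ i, k ≤ i → x i = 0) :
    weightSum {e ∈ E | e ⊆ range k} x = weightSum E x := by
  unfold weightSum
  refine sum_subset (filter_subset _ _) fun e he hne => ?_
  have : ¬ e ⊆ range k := fun h => hne (mem_filter.2 ⟨he, h⟩)
  obtain ⟨i, hi, hk⟩ := not_subset.1 this
  exact prod_eq_zero hi (hz i (by simpa using hk))

/-- An optimal pair stays optimal when restricted to the support of the weighting. -/
theorem IsOptimal.restrict (h : IsOptimal N M E x) {k : ℕ} (hk : k ≤ N)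
    (hz : ∀ i, k ≤ i → x i = 0) : IsOptimal k M {e ∈ E | e ⊆ range k} x where
  edges e he := by
    obtain ⟨h1, h2⟩ := mem_filter.1 he
    exact mem_powersetCard.2 ⟨h2, (mem_powersetCard.1 (h.edges h1)).2⟩
  card_le := (card_filter_le _ _).trans h.card_le
  nonneg := h.nonneg
  zero := hz
  sum_eq := by
    rw [← h.sum_eq]
    exact sum_subset (range_subset_range.2 hk) fun i _ hi => hz i (by simpa using hi)
  max E' x' h' := by
    rw [weightSum_filter_of_zero hz]
    refine h.max E' x' ⟨h'.edges.trans (powersetCard_mono (range_subset_range.2 hk)), h'.card_le,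
      h'.nonneg, fun i hi => h'.zero i (hk.trans hi), ?_⟩
    rw [← h'.sum_eq]
    exact (sum_subset (range_subset_range.2 hk) fun i _ hi => h'.zero i (by simpa using hi)).symm

/-- The triples of `range (r + 4)` that do not contain both `r + 2` and `r + 3`. -/
def twinGraph (r : ℕ) : Finset (Finset ℕ) :=
  {e ∈ powersetCard 3 (range (r + 4)) | ¬ (r + 2 ∈ e ∧ r + 3 ∈ e)}

theorem card_twinGraph (r : ℕ) : (twinGraph r).card = (r + 3).choose 3 + (r + 2).choose 2 := by
  have h1 : (twinGraph r).card = ∑ e ∈ powersetCard 3 (range (r + 4)),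
      if ¬ (r + 2 ∈ e ∧ r + 3 ∈ e) then 1 else 0 := by
    rw [twinGraph, card_filter]
  have hr : ∀ (m : ℕ), m ≤ 3 → ∀ p ∈ powersetCard m (range (r + 2)), r + 2 ∉ p ∧ r + 3 ∉ p := by
    intro m _ p hp
    constructor <;> intro h <;> have := mem_range.1 ((mem_powersetCard.1 hp).1 h) <;> omega
  have h2 : ((twinGraph r).card : ℝ) = ((r + 3).choose 3 + (r + 2).choose 2 : ℕ) := by
    rw [h1]
    push_cast
    have s0 : ∑ e ∈ powersetCard 3 (range (r + 2)),
        (if ¬ (r + 2 ∈ e ∧ r + 3 ∈ e) then (1 : ℝ) else 0) = ((r + 2).choose 3 : ℝ) := by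
      refine (sum_congr (g := fun _ => (1 : ℝ)) rfl fun e he => if_pos fun h => ?_).trans (by simp)
      exact (hr 3 le_rfl e he).1 h.1
    have s1 : ∑ e ∈ powersetCard 2 (range (r + 2)),
        (if ¬ (r + 2 ∈ insert (r + 2) e ∧ r + 3 ∈ insert (r + 2) e) then (1 : ℝ) else 0) =
          ((r + 2).choose 2 : ℝ) := by
      refine (sum_congr (g := fun _ => (1 : ℝ)) rfl fun e he => if_pos fun h => ?_).trans (by simp)
      exact (hr 2 (by omega) e he).2 (by simpa using h.2)
    have s2 : ∑ e ∈ powersetCard 2 (range (r + 2)),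
        (if ¬ (r + 2 ∈ insert (r + 3) e ∧ r + 3 ∈ insert (r + 3) e) then (1 : ℝ) else 0) =
          ((r + 2).choose 2 : ℝ) := by
      refine (sum_congr (g := fun _ => (1 : ℝ)) rfl fun e he => if_pos fun h => ?_).trans (by simp)
      exact (hr 2 (by omega) e he).1 (by simpa using h.1)
    have s3 : ∑ e ∈ powersetCard 1 (range (r + 2)), (if ¬ (r + 2 ∈ insert (r + 3) (insert (r + 2) e)
        ∧ r + 3 ∈ insert (r + 3) (insert (r + 2) e)) then (1 : ℝ) else 0) = 0 :=
      sum_eq_zero fun e _ => if_neg (not_not.2 ⟨by simp, by simp⟩)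
    rw [range_add_one, range_add_one, sum_powersetCard_insert (by simp),
      sum_powersetCard_insert (by simp), sum_powersetCard_insert (by simp), s0, s1, s2, s3,
      show (r + 3).choose 3 = (r + 2).choose 2 + (r + 2).choose 3 from Nat.choose_succ_succ _ _]
    push_cast
    ring
  exact_mod_cast h2

/-- The middle entry of a sorted twin triple is at most `r + 1`, so `{r, r + 1, r + 3}` dominates
the triple entrywise. -/
theorem le_prod_of_mem_twinGraph {r : ℕ} (hx : Antitone x) (h0 : ∀ i, 0 ≤ x i) {e : Finset ℕ}
    (he : e ∈ twinGraph r) : x r * x (r + 1) * x (r + 3) ≤ ∏ i ∈ e, x i := by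
  obtain ⟨he, hne⟩ := mem_filter.1 he
  obtain ⟨hs, hc⟩ := mem_powersetCard.1 he
  obtain ⟨a, b, c, hab, hbc, rfl⟩ := exists_sorted_triple hc
  have hc4 : c < r + 4 := mem_range.1 (hs (by simp))
  rw [prod_triple x hab hbc]
  have hb : b ≤ r + 1 := by
    by_contra hb
    exact hne ⟨by simp; omega, by simp; omega⟩
  exact prod_triple_le hx h0 (by omega) hb (by omega)

theorem le_prod_of_subset_range {r : ℕ} (hx : Antitone x) (h0 : ∀ i, 0 ≤ x i) {e : Finset ℕ}
    (he : e ∈ powersetCard 3 (range (r + 3))) : x r * x (r + 1) * x (r + 2) ≤ ∏ i ∈ e, x i := by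
  obtain ⟨hs, hc⟩ := mem_powersetCard.1 he
  obtain ⟨a, b, c, hab, hbc, rfl⟩ := exists_sorted_triple hc
  have hc4 : c < r + 3 := mem_range.1 (hs (by simp))
  rw [prod_triple x hab hbc]
  exact prod_triple_le hx h0 (by omega) (by omega) (by omega)

theorem le_prod_pair {r : ℕ} (hx : Antitone x) (h0 : ∀ i, 0 ≤ x i) {e : Finset ℕ}
    (he : e ∈ powersetCard 2 (range (r + 2))) : x r * x (r + 1) ≤ ∏ i ∈ e, x i := by
  obtain ⟨hs, hc⟩ := mem_powersetCard.1 he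
  obtain ⟨a, b, hab, rfl⟩ := exists_sorted_pair hc
  have hc4 : b < r + 2 := mem_range.1 (hs (by simp))
  rw [prod_pair hab.ne]
  exact mul_le_mul (hx (by omega)) (hx (by omega)) (h0 _) (h0 _)

/-- If the two largest vertices lie in a common edge of a compressed family, all triples through
the vertex `0` are edges. -/
theorem Compressed.insert_zero_mem (hE : Compressed E) {j i : ℕ} (hi : i < j)
    (h : {j, j + 1} ∪ {i} ∈ E) {p : Finset ℕ}
    (hp : p ∈ powersetCard 2 ((range (j + 2)).erase 0)) : insert 0 p ∈ E := by
  obtain ⟨hs, hc⟩ := mem_powersetCard.1 hp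
  obtain ⟨a, b, hab, rfl⟩ := exists_sorted_pair hc
  have ha := hs (show a ∈ ({a, b} : Finset ℕ) by simp)
  have hb := hs (show b ∈ ({a, b} : Finset ℕ) by simp)
  simp only [mem_erase, mem_range] at ha hb
  refine hE.mono_triple (a' := i) (b' := j) (c' := j + 1) (by omega) hab (by omega) (by omega)
    (by omega) (by omega) (by omega) ?_
  convert h using 1
  ext l
  simp only [mem_insert, mem_singleton, mem_union]
  tauto

end TripleSystem

/-! ### Numerical bounds for supports of at least `r + 5` vertices -/

namespace TripleSystem

variable {M : ℕ} {E : Finset (Finset ℕ)} {x : ℕ → ℝ}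

/-- The quotient `((pσ + κ)² - pσ²) / (1 + κ + pσ)²` is at most its value at `σ = 1`; after
cross-multiplication the difference factors into nonnegative terms. -/
theorem ratio_mono {p κ σ c : ℝ} (hp : 1 ≤ p) (hκ : 0 ≤ κ) (hσ0 : 0 ≤ σ) (hσ1 : σ ≤ 1)
    (h : c * (1 + κ + p * σ) ^ 2 ≤ (p * σ + κ) ^ 2 - p * σ ^ 2) :
    c * (1 + κ + p) ^ 2 ≤ (p + κ) ^ 2 - p := by
  have hD : 0 < 1 + κ + p * σ := by positivity
  have hD1 : 0 < 1 + κ + p := by positivity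
  have hid : ((p + κ) ^ 2 - p) * (1 + κ + p * σ) ^ 2 -
      ((p * σ + κ) ^ 2 - p * σ ^ 2) * (1 + κ + p) ^ 2 =
      p * (1 - σ) * ((p - 1) * (1 + κ + p * σ) + (1 + κ + p) * (κ * (1 - σ) + (p - 1) * σ)) := by
    ring
  have hnn : 0 ≤ p * (1 - σ) *
      ((p - 1) * (1 + κ + p * σ) + (1 + κ + p) * (κ * (1 - σ) + (p - 1) * σ)) := by
    have := sub_nonneg.2 hp
    have := sub_nonneg.2 hσ1
    positivity
  have h1 := mul_le_mul_of_nonneg_right h (sq_nonneg (1 + κ + p))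
  refine le_of_mul_le_mul_right ?_ (pow_pos hD 2)
  linarith

/-- The extreme case has `p` body weights equal to the head `a` and a tail of weight `κ * a`, so
that `a = 1 / (1 + κ + p)`. Here `σ` measures the average body weight relative to `a`. -/
theorem head_tail_bound {p κ a S τ Q c : ℝ} (hp : 1 ≤ p) (hκ : 0 ≤ κ) (ha : 0 < a)
    (hsum : a + S + τ = 1) (hS0 : 0 ≤ S) (hS : S ≤ p * a) (hτ0 : 0 ≤ τ) (hτ : τ ≤ κ * a)
    (hQ : S ^ 2 ≤ p * Q) (h : c ≤ (1 - a) ^ 2 - Q) : c * (1 + κ + p) ^ 2 ≤ (p + κ) ^ 2 - p := by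
  have hp0 : 0 < p := by linarith
  have ha' : a ≠ 0 := ha.ne'
  set σ := S / (p * a) with hσ
  have hSσ : S = p * a * σ := by rw [hσ]; field_simp
  have hσ0 : 0 ≤ σ := by positivity
  have hσ1 : σ ≤ 1 := by rw [hσ, div_le_one (by positivity)]; exact hS
  refine ratio_mono hp hκ hσ0 hσ1 ?_
  set T := a * (1 + κ + p * σ) with hT
  have hT1 : 1 ≤ T := by
    have : T = a + κ * a + p * a * σ := by rw [hT]; ring
    linarith
  have hQ' : p * (a * σ) ^ 2 ≤ Q := by
    rw [hSσ] at hQ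
    have : p * (p * (a * σ) ^ 2) ≤ p * Q := by linarith [hQ]
    exact le_of_mul_le_mul_left this hp0
  have h1 : (1 - a) * T ≤ T - a := by
    have : a * 1 ≤ a * T := mul_le_mul_of_nonneg_left hT1 ha.le
    linarith
  have h2 : ((1 - a) * T) ^ 2 ≤ (T - a) ^ 2 :=
    pow_le_pow_left₀ (mul_nonneg (by linarith) (by linarith)) h1 2
  have h3 : p * (a * σ) ^ 2 ≤ p * (a * σ) ^ 2 * T ^ 2 :=
    le_mul_of_one_le_right (by positivity) (one_le_pow₀ hT1)
  have h4 : c * T ^ 2 ≤ ((1 - a) ^ 2 - p * (a * σ) ^ 2) * T ^ 2 :=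
    mul_le_mul_of_nonneg_right (by linarith) (sq_nonneg T)
  have h5 : a ^ 2 * (c * (1 + κ + p * σ) ^ 2) ≤ a ^ 2 * ((p * σ + κ) ^ 2 - p * σ ^ 2) := by
    have e1 : a ^ 2 * (c * (1 + κ + p * σ) ^ 2) = c * T ^ 2 := by rw [hT]; ring
    have e2 : a ^ 2 * ((p * σ + κ) ^ 2 - p * σ ^ 2) = (T - a) ^ 2 - p * (a * σ) ^ 2 := by
      rw [hT]; ring
    rw [e1, e2]
    linarith
  exact le_of_mul_le_mul_left h5 (by positivity)

theorem large_support_arith {r j : ℕ} (hr : 2 ≤ r) (hj : r + 3 ≤ j)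
    (hM : (j + 1).choose 2 ≤ (r + 3).choose 3 + (r + 2).choose 2) {a S τ Q : ℝ} (ha : 0 < a)
    (hsum : a + S + τ = 1) (hS0 : 0 ≤ S) (hS : S ≤ (r - 1) * a) (hτ0 : 0 ≤ τ)
    (hτ : τ * (j + 1) ≤ 2 * (j + 2 - r) * a) (hQ : S ^ 2 ≤ (r - 1) * Q)
    (h : ((r : ℝ) + 2) * (r + 1) / (r + 3) ^ 2 ≤ (1 - a) ^ 2 - Q) : False := by
  have hr' : (2 : ℝ) ≤ r := by exact_mod_cast hr
  have hj' : (r : ℝ) + 3 ≤ j := by exact_mod_cast hj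
  have hτ' : ∀ κ : ℝ, 2 * ((j : ℝ) + 2 - r) ≤ κ * (j + 1) → τ ≤ κ * a := fun κ hκ => by
    have : τ * (j + 1) ≤ κ * a * (j + 1) := by nlinarith
    exact le_of_mul_le_mul_right this (by positivity)
  rcases lt_or_ge r 4 with h4 | h4
  -- The uniform choice `κ = 2` below fails for `r = 2, 3`. There the bound on `(j + 1).choose 2`
  -- limits `j` to `5` and to `6, 7`, which permits the smaller ratios `5 / 3` and `3 / 2`.
  · interval_cases r
    · have hj6 : j < 6 := by
        by_contra hc
        have h1 := Nat.choose_le_choose 2 (show 7 ≤ j + 1 by omega)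
        have h2 := h1.trans hM
        revert h2; decide
      have : j = 5 := by omega
      subst this
      have := head_tail_bound (κ := 5 / 3) (by norm_num) (by norm_num) ha hsum hS0 hS hτ0
        (hτ' _ (by norm_num)) hQ h
      norm_num at this
    · have hj8 : j < 8 := by
        by_contra hc
        have h1 := Nat.choose_le_choose 2 (show 9 ≤ j + 1 by omega)
        have h2 := h1.trans hM
        revert h2; decide
      have hj8' : (j : ℝ) ≤ 7 := by exact_mod_cast (by omega : j ≤ 7)
      have := head_tail_bound (κ := 3 / 2) (by norm_num) (by norm_num) ha hsum hS0 hS hτ0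
        (hτ' _ (by push_cast; linarith)) hQ h
      norm_num at this
  · have h4' : (4 : ℝ) ≤ r := by exact_mod_cast h4
    have := head_tail_bound (κ := 2) (by linarith) (by norm_num) ha hsum hS0 hS hτ0
      (hτ' _ (by linarith)) hQ h
    rw [div_mul_eq_mul_div, div_le_iff₀ (by positivity)] at this
    -- After clearing denominators the inequality to refute reads `r² - r - 10 ≤ 0`.
    nlinarith [mul_nonneg (sub_nonneg.2 h4') (sub_nonneg.2 h4')]

end TripleSystem

/-! ### Merging the last two vertices; excluding large supports -/

namespace TripleSystem

variable {M : ℕ} {E : Finset (Finset ℕ)} {x : ℕ → ℝ}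

theorem erase_erase_range (j : ℕ) : ((range (j + 2)).erase j).erase (j + 1) = range j := by
  ext i
  simp only [mem_erase, mem_range]
  omega

theorem insert_insert_range (j : ℕ) : insert (j + 1) (insert j (range j)) = range (j + 2) := by
  rw [range_add_one, range_add_one]

/-- Merging the weight of the last vertex into the last but one. -/
def mergeLast (x : ℕ → ℝ) (j : ℕ) : ℕ → ℝ := move x j (j + 1) (x j + x (j + 1)) 0

theorem mergeLast_last (x : ℕ → ℝ) (j : ℕ) : mergeLast x j (j + 1) = 0 := move_right ..

theorem mergeLast_self (x : ℕ → ℝ) (j : ℕ) : mergeLast x j j = x j + x (j + 1) :=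
  move_left _ (by omega) _ _

theorem mergeLast_of_lt (x : ℕ → ℝ) {i j : ℕ} (h : i < j) : mergeLast x j i = x i :=
  move_of_ne _ (by omega) (by omega) _ _

theorem le_mergeLast (hx : ∀ i, 0 ≤ x i) {i j : ℕ} (h : i ≤ j) : x i ≤ mergeLast x j i := by
  rcases h.eq_or_lt with rfl | h
  · rw [mergeLast_self]; linarith [hx (i + 1)]
  · rw [mergeLast_of_lt x h]

theorem Feasible.mergeLast {j : ℕ} (h : Feasible (j + 2) M E x) :
    Feasible (j + 2) M E (mergeLast x j) :=
  h.move (by omega) (by omega) (by omega) (add_nonneg (h.nonneg _) (h.nonneg _)) le_rfl (by ring)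

theorem IsOptimal.link_last {j : ℕ} (h : IsOptimal (j + 2) M E x) (hpos : ∀ i < j + 2, 0 < x i) :
    linkSum E (range j) x {j} 2 + x (j + 1) * linkSum E (range j) x {j, j + 1} 1 =
      linkSum E (range j) x {j + 1} 2 + x j * linkSum E (range j) x {j, j + 1} 1 := by
  have := h.link_eq (i := j) (j := j + 1) (by omega) (by omega) (by omega) (hpos _ (by omega))
    (hpos _ (by omega))
  rwa [erase_erase_range] at this

theorem weightSum_split_last {j : ℕ} (hE : E ⊆ powersetCard 3 (range (j + 2))) (x : ℕ → ℝ) :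
    weightSum E x = linkSum E (range j) x ∅ 3 + x j * linkSum E (range j) x {j} 2 +
      x (j + 1) * linkSum E (range j) x {j + 1} 2 +
      x j * x (j + 1) * linkSum E (range j) x {j, j + 1} 1 :=
  weightSum_split (by simp) (by simp) (by omega) (by rwa [insert_insert_range]) x

/-- The first-order condition at the last two vertices cancels the linear change and leaves only a
second-order loss. -/
theorem IsOptimal.weightSum_mergeLast {j : ℕ} (h : IsOptimal (j + 2) M E x)
    (hpos : ∀ i < j + 2, 0 < x i) :
    weightSum E (mergeLast x j) =
      weightSum E x - x (j + 1) ^ 2 * linkSum E (range j) x {j, j + 1} 1 := by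
  rw [mergeLast, weightSum_move h.edges (by simp) (by simp) (by omega), erase_erase_range,
    weightSum_split_last h.edges x]
  linear_combination x (j + 1) * h.link_last hpos

theorem linkSum_one_eq (E : Finset (Finset ℕ)) (s : Finset ℕ) (x : ℕ → ℝ) (t : Finset ℕ) :
    linkSum E s x t 1 = ∑ i ∈ s with t ∪ {i} ∈ E, x i := by
  simp [linkSum, powersetCard_one, sum_filter]

/-- Twice the degree of the last vertex is at least `j + 1` times its codegree with the last but
one. -/
theorem Compressed.card_filter_last {j : ℕ} (hE : Compressed E) :
    #{i ∈ range j | {j, j + 1} ∪ {i} ∈ E} * (j + 1) ≤ 2 * #{e ∈ E | j + 1 ∈ e} := by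
  set B := {i ∈ range j | {j, j + 1} ∪ {i} ∈ E} with hB
  have hBj : ∀ i ∈ B, i < j := fun i hi => mem_range.1 (mem_filter.1 hi).1
  have hBE : ∀ i ∈ B, {j, j + 1} ∪ {i} ∈ E := fun i hi => (mem_filter.1 hi).2
  have h1 : #B ≤ #{e ∈ E | j + 1 ∈ e ∧ j ∈ e} := by
    refine card_le_card_of_injOn (fun i => {j, j + 1} ∪ {i}) (fun i hi => ?_) fun a ha b hb hab => ?_
    · exact mem_filter.2 ⟨hBE i hi, by simp, by simp⟩
    · have ha' := hBj a ha
      have : a ∈ ({j, j + 1} ∪ {b} : Finset ℕ) := by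
        have hab' : ({j, j + 1} ∪ {a} : Finset ℕ) = {j, j + 1} ∪ {b} := hab
        rw [← hab']; simp
      simp only [mem_union, mem_insert, mem_singleton] at this
      omega
  set P : Finset (Σ _ : ℕ, ℕ) := B.sigma fun i => (range j).erase i with hP
  have hmem : ∀ q ∈ P, q.1 ∈ B ∧ q.2 ≠ q.1 ∧ q.2 < j := fun q hq => by
    simpa [hP] using hq
  have h2 : #P = #B * (j - 1) := by
    rw [hP, card_sigma, sum_congr rfl fun i hi => by
      rw [card_erase_of_mem (mem_range.2 (hBj i hi)), card_range], sum_const, smul_eq_mul]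
  have h3 : #P ≤ 2 * #{e ∈ E | j + 1 ∈ e ∧ j ∉ e} := by
    refine card_le_mul_card_image_of_maps_to
      (f := fun q : (Σ _ : ℕ, ℕ) => ({q.1, q.2, j + 1} : Finset ℕ)) (fun q hq => ?_) 2 fun e _ => ?_
    · obtain ⟨hq1, hq2, hq3⟩ := hmem q hq
      have hq4 := hBj _ hq1
      refine mem_filter.2 ⟨?_, by simp, by simp; omega⟩
      have := hE _ (hBE _ hq1) j (by simp) q.2 hq3 (by simp; omega)
      convert this using 1
      ext l
      simp only [mem_insert, mem_singleton, mem_erase, mem_union]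
      omega
    · rcases (P.filter fun q => ({q.1, q.2, j + 1} : Finset ℕ) = e).eq_empty_or_nonempty with h | h
      · rw [h]; simp
      obtain ⟨q, hq⟩ := h
      obtain ⟨hqP, hqe⟩ := mem_filter.1 hq
      have hq' := hmem q hqP
      have hq4 := hBj _ hq'.1
      refine (card_le_card (t := {q, ⟨q.2, q.1⟩}) fun q' h' => ?_).trans card_le_two
      obtain ⟨hqP', hqe'⟩ := mem_filter.1 h'
      have hq'' := hmem q' hqP'
      have hq4' := hBj _ hq''.1
      have e1 : q'.1 ∈ ({q.1, q.2, j + 1} : Finset ℕ) := by rw [hqe, ← hqe']; simp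
      have e2 : q'.2 ∈ ({q.1, q.2, j + 1} : Finset ℕ) := by rw [hqe, ← hqe']; simp
      simp only [mem_insert, mem_singleton] at e1 e2 ⊢
      obtain ⟨a, b⟩ := q
      obtain ⟨a', b'⟩ := q'
      simp only [Sigma.mk.injEq, heq_eq_eq] at *
      omega
  have h4 : #{e ∈ E | j + 1 ∈ e} = #{e ∈ E | j + 1 ∈ e ∧ j ∈ e} + #{e ∈ E | j + 1 ∈ e ∧ j ∉ e} := by
    rw [← card_filter_add_card_filter_not (s := {e ∈ E | j + 1 ∈ e}) (fun e => j ∈ e), filter_filter,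
      filter_filter]
  rcases Nat.eq_zero_or_pos j with rfl | hj
  · simp [hB]
  have : #B * (j + 1) = #B * (j - 1) + 2 * #B := by
    rw [mul_comm 2, ← mul_add]; congr 1; omega
  omega

theorem weightSum_mono {E F : Finset (Finset ℕ)} (h : E ⊆ F) (hx : ∀ i, 0 ≤ x i) :
    weightSum E x ≤ weightSum F x :=
  sum_le_sum_of_subset_of_nonneg h fun _ _ _ => prod_nonneg fun i _ => hx i

theorem sum_sq_erase_zero_le {r k : ℕ} (hrk : r ≤ k) :
    ∑ i ∈ Ico 1 r, x i ^ 2 ≤ ∑ i ∈ (range k).erase 0, x i ^ 2 := by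
  refine sum_le_sum_of_subset_of_nonneg (fun i hi => ?_) fun i _ _ => sq_nonneg _
  simp only [mem_Ico, mem_erase, mem_range] at hi ⊢
  omega

/-- The derivative at the vertex `0` is bounded by the quadratic symmetric sum of the others. -/
theorem IsOptimal.six_mul_weightSum_le {k : ℕ} (h : IsOptimal k M E x) (hpos : ∀ i < k, 0 < x i)
    (hk : 0 < k) :
    6 * weightSum E x ≤ (1 - x 0) ^ 2 - ∑ i ∈ (range k).erase 0, x i ^ 2 := by
  have h1 := h.deriv_eq_three_mul hpos hk
  have h2 := linkSum_le_esum E ((range k).erase 0) h.nonneg {0} 2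
  have h3 := two_mul_esum_two ((range k).erase 0) x
  have h4 : ∑ i ∈ (range k).erase 0, x i = 1 - x 0 := by
    rw [← h.sum_eq, ← sum_erase_add _ _ (mem_range.2 hk)]; ring
  rw [h4] at h3
  linarith

/-- The weight of `D` twin graph triples gained after merging the last vertex is at most the
loss caused by merging. -/
theorem IsOptimal.degree_last_mul_le {r j : ℕ} (hj : r + 3 ≤ j)
    (h : IsOptimal (j + 2) ((r + 3).choose 3 + (r + 2).choose 2) E x)
    (hpos : ∀ i < j + 2, 0 < x i) (hx : Antitone x) :
    #{e ∈ E | j + 1 ∈ e} * (x r * x (r + 1) * x (r + 3)) ≤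
      x (j + 1) ^ 2 * linkSum E (range j) x {j, j + 1} 1 := by
  set D := #{e ∈ E | j + 1 ∈ e} with hD
  -- Edges through `j + 1` lie outside the twin graph, and `E` is no larger than the twin graph, so
  -- at least as many twin triples are absent from `E`.
  have hD1 : D ≤ #(twinGraph r \ E) := by
    have h1 : #E ≤ #(twinGraph r) := by rw [card_twinGraph]; exact h.card_le
    refine le_trans (card_le_card fun e he => ?_) (card_sdiff_le_card_sdiff_iff.2 h1)
    obtain ⟨he, hje⟩ := mem_filter.1 he
    refine mem_sdiff.2 ⟨he, fun ht => ?_⟩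
    have := mem_range.1 ((mem_powersetCard.1 (mem_filter.1 ht).1).1 hje)
    omega
  obtain ⟨R, hR, hRD⟩ := exists_subset_card_eq hD1
  set E₀ := {e ∈ E | j + 1 ∉ e} with hE₀
  have hdisj : Disjoint E₀ R := disjoint_left.2 fun e he hr =>
    (mem_sdiff.1 (hR hr)).2 (mem_filter.1 he).1
  have hcard : #(E₀ ∪ R) = #E := by
    rw [card_union_of_disjoint hdisj, hRD, hD, hE₀, add_comm]
    exact card_filter_add_card_filter_not _
  have hm := h.toFeasible.mergeLast
  have hF : Feasible (j + 2) ((r + 3).choose 3 + (r + 2).choose 2) (E₀ ∪ R) (TripleSystem.mergeLast x j) := by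
    refine ⟨union_subset ((filter_subset _ _).trans h.edges) fun e he => ?_, hcard ▸ h.card_le,
      hm.nonneg, hm.zero, hm.sum_eq⟩
    exact powersetCard_mono (range_subset_range.2 (by omega))
      (mem_filter.1 (mem_sdiff.1 (hR he)).1).1
  have h1 := h.max _ _ hF
  have h2 : weightSum (E₀ ∪ R) (TripleSystem.mergeLast x j) =
      weightSum E₀ (TripleSystem.mergeLast x j) + weightSum R (TripleSystem.mergeLast x j) := by
    unfold weightSum
    exact sum_union hdisj
  have h3 : weightSum E₀ (TripleSystem.mergeLast x j) =
      weightSum E (TripleSystem.mergeLast x j) := by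
    unfold weightSum
    refine sum_subset (filter_subset _ _) fun e he hne => ?_
    have : j + 1 ∈ e := by
      by_contra hc
      exact hne (mem_filter.2 ⟨he, hc⟩)
    exact prod_eq_zero this (mergeLast_last x j)
  have h4 : D * (x r * x (r + 1) * x (r + 3)) ≤ weightSum R (TripleSystem.mergeLast x j) := by
    rw [← hRD, ← nsmul_eq_mul]
    refine card_nsmul_le_sum _ _ _ fun e he => ?_
    have het := (mem_sdiff.1 (hR he)).1
    refine (le_prod_of_mem_twinGraph hx h.nonneg het).trans
      (prod_le_prod (fun i _ => h.nonneg i) fun i hi => le_mergeLast h.nonneg ?_)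
    have := mem_range.1 ((mem_powersetCard.1 (mem_filter.1 het).1).1 hi)
    omega
  rw [h2, h3, h.weightSum_mergeLast hpos] at h1
  linarith

/-- Optimal weightings have at most `r + 4` vertices in their support. -/
theorem IsOptimal.false_of_large_support {r j : ℕ} (hr : 2 ≤ r) (hj : r + 3 ≤ j)
    (h : IsOptimal (j + 2) ((r + 3).choose 3 + (r + 2).choose 2) E x)
    (hpos : ∀ i < j + 2, 0 < x i) (hx : Antitone x) (hE : Compressed E)
    (hL : ((r : ℝ) + 2) * (r + 1) / (r + 3) ^ 2 ≤ 6 * weightSum E x) : False := by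
  have hD := h.degree_last_mul_le hj hpos hx
  have hDB := hE.card_filter_last (j := j)
  set D := #{e ∈ E | j + 1 ∈ e} with hDdef
  set B := {i ∈ range j | {j, j + 1} ∪ {i} ∈ E} with hB
  have hx0 : ∀ i ≤ j + 1, 0 < x i := fun i hi => hpos i (by omega)
  have hC : linkSum E (range j) x {j, j + 1} 1 ≤ #B * x 0 := by
    rw [linkSum_one_eq, ← nsmul_eq_mul]
    exact sum_le_card_nsmul _ _ _ fun i _ => hx (Nat.zero_le i)
  -- A vertex in no edge would have derivative zero, whereas every derivative equals three times the
  -- positive optimum.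
  have hDpos : 0 < D := by
    rw [hDdef, card_pos]
    by_contra hne
    rw [not_nonempty_iff_eq_empty] at hne
    have h1 := mul_linkSum_eq h.edges (show j + 1 ∈ range (j + 2) by simp) x
    rw [hne, h.deriv_eq_three_mul hpos (by omega)] at h1
    have h2 : 0 < 6 * weightSum E x := lt_of_lt_of_le (by positivity) hL
    have := hx0 (j + 1) le_rfl
    simp at h1
    rcases h1 with h1 | h1 <;> linarith
  set a := x 0
  set y := x (j + 1)
  have ha : 0 < a := hx0 0 (by omega)
  have hy : 0 < y := hx0 (j + 1) le_rfl
  have hr0 : 0 < x r := hx0 r (by omega)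
  have hprod : x r * y ^ 2 ≤ x r * x (r + 1) * x (r + 3) := by
    have h1 : y ≤ x (r + 1) := hx (by omega)
    have h2 : y ≤ x (r + 3) := hx (by omega)
    rw [mul_assoc, sq]
    exact mul_le_mul_of_nonneg_left (mul_le_mul h1 h2 hy.le (h.nonneg _)) hr0.le
  have h1 : (D : ℝ) * x r ≤ #B * a := by
    have : (D * x r) * y ^ 2 ≤ (#B * a) * y ^ 2 := by
      calc (D * x r) * y ^ 2 = D * (x r * y ^ 2) := by ring
        _ ≤ D * (x r * x (r + 1) * x (r + 3)) := by gcongr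
        _ ≤ _ := hD
        _ ≤ y ^ 2 * (#B * a) := by gcongr
        _ = _ := by ring
    exact le_of_mul_le_mul_right this (by positivity)
  have hBpos : 0 < #B := by
    rcases Nat.eq_zero_or_pos #B with h0 | h0
    · rw [h0] at h1
      have : (0 : ℝ) < D * x r := by positivity
      simp at h1
      linarith
    · exact h0
  -- The codegree `#B` cancels: each weight from index `r` on is at most `2 / (j + 1)` times the
  -- largest.
  have h2 : (j + 1) * x r ≤ 2 * a := by
    have hDB' : (#B : ℝ) * (j + 1) ≤ 2 * D := by exact_mod_cast hDB
    have hB' : (0 : ℝ) < #B := by exact_mod_cast hBpos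
    have : #B * ((j + 1) * x r) ≤ #B * (2 * a) := by nlinarith
    exact le_of_mul_le_mul_left this hB'
  obtain ⟨i₀, hi₀⟩ := card_pos.1 hBpos
  obtain ⟨hi₁, hi₂⟩ := mem_filter.1 hi₀
  have hM : (j + 1).choose 2 ≤ (r + 3).choose 3 + (r + 2).choose 2 := by
    refine le_trans ?_ h.card_le
    have hc : #(powersetCard 2 ((range (j + 2)).erase 0)) = (j + 1).choose 2 := by
      rw [card_powersetCard, card_erase_of_mem (by simp), card_range]; rfl
    rw [← hc]
    refine card_le_card_of_injOn (insert 0) (fun p hp => ?_) fun p hp q hq hpq => ?_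
    · exact hE.insert_zero_mem (mem_range.1 hi₁) hi₂ hp
    · have hp' : 0 ∉ p := fun h' => by simpa using (mem_powersetCard.1 hp).1 h'
      have hq' : 0 ∉ q := fun h' => by simpa using (mem_powersetCard.1 hq).1 h'
      rw [← erase_insert hp', ← erase_insert hq', hpq]
  have hr' : (2 : ℝ) ≤ r := by exact_mod_cast hr
  have hsplit : ∑ i ∈ range (j + 2), x i = a + ∑ i ∈ Ico 1 r, x i + ∑ i ∈ Ico r (j + 2), x i := by
    rw [range_eq_Ico, ← sum_Ico_consecutive x (Nat.zero_le r) (by omega),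
      ← sum_Ico_consecutive x (Nat.zero_le 1) (by omega)]
    simp [a]
  have hcard1 : ((Ico 1 r).card : ℝ) = r - 1 := by
    rw [Nat.card_Ico, Nat.cast_sub (by omega)]; simp
  have hcard2 : ((Ico r (j + 2)).card : ℝ) = j + 2 - r := by
    rw [Nat.card_Ico, Nat.cast_sub (by omega)]; push_cast; ring
  refine large_support_arith hr hj hM ha (S := ∑ i ∈ Ico 1 r, x i)
    (τ := ∑ i ∈ Ico r (j + 2), x i) (Q := ∑ i ∈ Ico 1 r, x i ^ 2) ?_ ?_ ?_ ?_ ?_ ?_ ?_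
  · rw [← hsplit]; exact h.sum_eq
  · exact sum_nonneg fun i _ => h.nonneg i
  · rw [← hcard1, ← nsmul_eq_mul]
    exact sum_le_card_nsmul _ _ _ fun i _ => hx (Nat.zero_le i)
  · exact sum_nonneg fun i _ => h.nonneg i
  · have h3 : ∑ i ∈ Ico r (j + 2), x i ≤ (j + 2 - r) * x r := by
      rw [← hcard2, ← nsmul_eq_mul]
      exact sum_le_card_nsmul _ _ _ fun i hi => hx (mem_Ico.1 hi).1
    have h4 : (0 : ℝ) ≤ j + 2 - r := by rw [← hcard2]; positivity
    calc (∑ i ∈ Ico r (j + 2), x i) * (j + 1) ≤ (j + 2 - r) * x r * (j + 1) := by gcongr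
      _ = (j + 2 - r) * ((j + 1) * x r) := by ring
      _ ≤ (j + 2 - r) * (2 * a) := by gcongr
      _ = _ := by ring
  · rw [← hcard1]; exact sq_sum_le_card_mul_sum_sq
  · have h3 := h.six_mul_weightSum_le hpos (by omega)
    have h4 := sum_sq_erase_zero_le (x := x) (show r ≤ j + 2 by omega)
    linarith

end TripleSystem

/-! ### Numerical bounds for supports of exactly `r + 4` vertices -/

namespace TripleSystem

theorem quartic_pos_of_small {g : ℝ} (h1 : 1 / 2 ≤ g) (h2 : g ≤ 5 / 4) :
    0 < 17 / 6 * (1 - g) ^ 2 - (g + g ^ 2 / 4 - 2 * g ^ 3 + 6 / 17 * g ^ 4) := by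
  have e1 := sub_nonneg.2 h1
  have e2 := sub_nonneg.2 h2
  nlinarith [mul_nonneg (mul_nonneg e1 e2) (sq_nonneg (g - 3 / 4)),
    mul_nonneg e1 (sq_nonneg (g - 3 / 4)), mul_nonneg e2 (sq_nonneg (g - 3 / 4))]

theorem cubic_pos {g : ℝ} (h1 : 1 / 2 ≤ g) :
    0 < 2 * (1 - g) ^ 2 - (g + g ^ 2 / 4 - 2 * g ^ 3) := by
  nlinarith [mul_nonneg (by linarith : 0 ≤ 2 * g + 53 / 12) (sq_nonneg (g - 2 / 3))]

theorem quartic_pos {g : ℝ} (h1 : 1 / 2 ≤ g) (h2 : g ≤ 5 / 4) :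
    0 < 23 / 6 * (2 * (1 - g) ^ 2 - (g + g ^ 2 / 4 - 2 * g ^ 3)) +
      (5 / 3 * (1 - g) ^ 2 - g ^ 4) := by
  have e1 := sub_nonneg.2 h1
  have e2 := sub_nonneg.2 h2
  nlinarith [mul_nonneg (mul_nonneg e1 e2) (sq_nonneg (g - 7 / 10)),
    mul_nonneg e1 (sq_nonneg (g - 7 / 10)), mul_nonneg e2 (sq_nonneg (g - 7 / 10))]

/-- Successive elimination of `V`, `α` and `ζ` leaves a polynomial inequality in `g` alone, which
fails. For `g < 1 / 2` the bound `V ≥ 1 - 2g²` already suffices. -/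
theorem twin_arith_core {b K K' α g ζ V : ℝ} (hb : 1 ≤ b) (hb2 : b ≤ 2 ∨ 3 ≤ b)
    (hK : b + 5 / 6 ≤ K) (hK17 : 17 / 6 ≤ K) (hK' : b ≤ K') (hg : 0 < g) (hα : α ≤ 5 / 4)
    (hgα : g ≤ α) (hζ0 : 0 ≤ ζ) (hζ : ζ ≤ 2 * g) (hV1 : 1 / 2 ≤ g → 2 * (1 - g) ^ 2 ≤ V)
    (hV2 : 1 - 2 * g ^ 2 ≤ V)
    (h : K * (b * (α - 1) ^ 2 + V) + K' * (ζ - 1) ^ 2 ≤ b * (α * g * ζ - 2 * g ^ 3)) : False := by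
  have hK0 : 0 < K := by linarith
  have hζ1 : b * (ζ - 1) ^ 2 ≤ K' * (ζ - 1) ^ 2 := by gcongr
  rcases lt_or_ge g (1 / 2) with hg2 | hg2
  · have hV0 : 0 ≤ V := by nlinarith
    have h1 : b * V ≤ K * V := by gcongr; linarith
    have h2 : b * V ≤ b * (α * g * ζ - 2 * g ^ 3) := by
      have : 0 ≤ K * (b * (α - 1) ^ 2) := by positivity
      have : 0 ≤ b * (ζ - 1) ^ 2 := by positivity
      linarith
    have h3 := le_of_mul_le_mul_left h2 (by linarith)
    have h4 : α * g * ζ ≤ 5 / 4 * g * (2 * g) := by gcongr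
    nlinarith [mul_pos hg hg, mul_pos (mul_pos hg hg) hg]
  · have hA : α * g * ζ - K * (α - 1) ^ 2 ≤ g * ζ + g ^ 4 / K := by
      have h0 : 2 * (α - 1) * g ^ 2 - K * (α - 1) ^ 2 ≤ g ^ 4 / K := by
        rw [le_div_iff₀ hK0]
        nlinarith [sq_nonneg (g ^ 2 - K * (α - 1))]
      rcases le_or_gt 1 α with h1 | h1
      · have : (α - 1) * g * ζ ≤ (α - 1) * g * (2 * g) := by
          have := sub_nonneg.2 h1
          gcongr
        nlinarith
      · have : 0 ≤ (1 - α) * (g * ζ) := mul_nonneg (by linarith) (by positivity)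
        have : 0 ≤ K * (α - 1) ^ 2 := by positivity
        have : 0 ≤ g ^ 4 / K := by positivity
        linarith
    have hV := hV1 hg2
    have h1 : 2 * K * (1 - g) ^ 2 ≤ b * (g + g ^ 2 / 4 - 2 * g ^ 3 + g ^ 4 / K) := by
      have e1 : K * (2 * (1 - g) ^ 2) ≤ K * V := by gcongr
      have e2 : b * (α * g * ζ - K * (α - 1) ^ 2) ≤ b * (g * ζ + g ^ 4 / K) := by gcongr
      have e3 : b * (g * ζ - (ζ - 1) ^ 2) ≤ b * (g + g ^ 2 / 4) := by
        gcongr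
        nlinarith [sq_nonneg (ζ - 1 - g / 2)]
      linarith
    have hg54 : g ≤ 5 / 4 := hgα.trans hα
    rcases hb2 with hb2 | hb3
    · have hq := quartic_pos_of_small hg2 hg54
      have e1 : g ^ 4 / K ≤ 6 / 17 * g ^ 4 := by
        rw [div_le_iff₀ hK0]
        nlinarith [pow_pos hg 4]
      have e2 : 2 * (17 / 6) * (1 - g) ^ 2 ≤ 2 * K * (1 - g) ^ 2 := by gcongr
      have e3 : b * (g + g ^ 2 / 4 - 2 * g ^ 3 + g ^ 4 / K) ≤
          b * (g + g ^ 2 / 4 - 2 * g ^ 3 + 6 / 17 * g ^ 4) := by gcongr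
      nlinarith [sq_nonneg (1 - g)]
    -- Since `b * (k + 5 / 6) = k² - 25 / 36 ≤ k²`, `b` can be traded for `k`. The remaining
    -- expression is affine in `k` with positive slope `φ₀`, so it is enough to check `k = 23 / 6`,
    -- that is `b = 3`.
    · set k := b + 5 / 6 with hk
      have hk0 : 0 < k := by linarith
      have e1 : g ^ 4 / K ≤ g ^ 4 / k := by gcongr
      have e2 : 2 * k * (1 - g) ^ 2 ≤ b * (g + g ^ 2 / 4 - 2 * g ^ 3 + g ^ 4 / k) := by
        have : b * (g + g ^ 2 / 4 - 2 * g ^ 3 + g ^ 4 / K) ≤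
          b * (g + g ^ 2 / 4 - 2 * g ^ 3 + g ^ 4 / k) := by gcongr
        have : 2 * k * (1 - g) ^ 2 ≤ 2 * K * (1 - g) ^ 2 := by gcongr
        linarith
      have e3 : 2 * k ^ 2 * (1 - g) ^ 2 ≤ b * (k * (g + g ^ 2 / 4 - 2 * g ^ 3) + g ^ 4) := by
        calc 2 * k ^ 2 * (1 - g) ^ 2 = k * (2 * k * (1 - g) ^ 2) := by ring
          _ ≤ k * (b * (g + g ^ 2 / 4 - 2 * g ^ 3 + g ^ 4 / k)) := by gcongr
          _ = _ := by field_simp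
      have hφ := quartic_pos hg2 hg54
      have hφ0 := cubic_pos hg2
      set φ₀ := 2 * (1 - g) ^ 2 - (g + g ^ 2 / 4 - 2 * g ^ 3) with hφ₀
      have e4 : 0 < k * φ₀ + (5 / 3 * (1 - g) ^ 2 - g ^ 4) := by
        have : 0 ≤ (k - 23 / 6) * φ₀ := mul_nonneg (by linarith) hφ0.le
        linarith
      have e5 : 0 < b * (k * φ₀ + (5 / 3 * (1 - g) ^ 2 - g ^ 4)) := mul_pos (by linarith) e4
      have e6 : b * (k * (g + g ^ 2 / 4 - 2 * g ^ 3) + g ^ 4) =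
          2 * (1 - g) ^ 2 * (b * (k + 5 / 6)) -
            b * (k * φ₀ + (5 / 3 * (1 - g) ^ 2 - g ^ 4)) := by rw [hφ₀]; ring
      have e7 : 2 * (1 - g) ^ 2 * (b * (k + 5 / 6)) ≤ 2 * (1 - g) ^ 2 * k ^ 2 := by
        gcongr
        have : b * (k + 5 / 6) = k ^ 2 - 25 / 36 := by rw [hk]; ring
        linarith
      linarith

/-- With `g` the geometric mean of `v₁` and `v₂`, both `ω` and `η` lie in `[g² / α, g]`. Replacing
their squares by the chord over this interval makes the right side linear in `ω + η`. -/
theorem twin_arith {b K K' α v₁ v₂ ω η : ℝ} (hb : 1 ≤ b) (hb2 : b ≤ 2 ∨ 3 ≤ b)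
    (hK : b + 5 / 6 ≤ K) (hK17 : 17 / 6 ≤ K) (hK' : b ≤ K') (hα : α ≤ 5 / 4) (h1 : v₁ ≤ α)
    (h2 : v₂ ≤ v₁) (h3 : ω ≤ v₂) (h4 : η ≤ ω) (hη : 0 < η) (hex : v₁ * v₂ ≤ α * η)
    (h : b * (ω + η) * (v₁ * v₂) + (K * (b * (α - 1) ^ 2 + ((v₁ - 1) ^ 2 + (v₂ - 1) ^ 2)) +
      K' * (ω + η - 1) ^ 2) ≤ b * α * (ω ^ 2 + η ^ 2)) : False := by
  have hv2 : 0 < v₂ := by linarith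
  have hv1 : 0 < v₁ := by linarith
  have hα0 : 0 < α := by linarith
  set g := √(v₁ * v₂) with hg
  have hgg : g ^ 2 = v₁ * v₂ := Real.sq_sqrt (by positivity)
  have hg0 : 0 < g := Real.sqrt_pos.2 (by positivity)
  have hωg : ω ≤ g := Real.le_sqrt_of_sq_le (by nlinarith)
  have hgα : g ≤ α := by
    refine (Real.sqrt_le_left hα0.le).2 ?_
    nlinarith
  have hη' : g ^ 2 ≤ α * η := by rw [hgg]; exact hex
  rw [← hgg] at h
  refine twin_arith_core (g := g) (ζ := ω + η) (V := (v₁ - 1) ^ 2 + (v₂ - 1) ^ 2) hb hb2 hK hK17 hK'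
    hg0 hα hgα (by linarith) (by linarith) (fun hg2 => ?_) ?_ ?_
  · have hS : 2 * g ≤ v₁ + v₂ := by
      by_contra hc
      push Not at hc
      have e1 := mul_pos (sub_pos.2 hc) (show 0 < 2 * g + (v₁ + v₂) by linarith)
      have e2 := sq_nonneg (v₁ - v₂)
      linarith
    have e1 := mul_nonneg (sub_nonneg.2 hS) (show 0 ≤ v₁ + v₂ + 2 * g - 2 by linarith)
    linarith
  · have e1 := sq_nonneg (v₁ + v₂ - 1)
    linarith
  · have e1 : 0 ≤ (g - ω) * (α * ω - g ^ 2) := mul_nonneg (by linarith)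
      (by linarith [mul_le_mul_of_nonneg_left h4 hα0.le])
    have e2 : 0 ≤ (g - η) * (α * η - g ^ 2) := mul_nonneg (by linarith) (by linarith)
    have e3 : b * (α * (ω ^ 2 + η ^ 2)) ≤ b * ((α * g + g ^ 2) * (ω + η) - 2 * g ^ 3) := by
      gcongr
      linarith
    linarith

end TripleSystem

/-! ### Support `r + 4`: absent triples and the clique case -/

namespace TripleSystem

variable {M : ℕ} {E : Finset (Finset ℕ)} {x : ℕ → ℝ}

/-- The number of `m`-subsets `p` of `s` for which `t ∪ p` does not belong to `E`. -/
def missCard (E : Finset (Finset ℕ)) (s t : Finset ℕ) (m : ℕ) : ℕ :=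
  #{p ∈ powersetCard m s | t ∪ p ∉ E}

theorem missSum_eq_sum_filter (E : Finset (Finset ℕ)) (s : Finset ℕ) (x : ℕ → ℝ) (t : Finset ℕ)
    (m : ℕ) : missSum E s x t m = ∑ p ∈ powersetCard m s with t ∪ p ∉ E, ∏ i ∈ p, x i := by
  rw [missSum, sum_filter]
  refine sum_congr rfl fun p _ => ?_
  split_ifs <;> rfl

theorem missSum_const_one (E : Finset (Finset ℕ)) (s t : Finset ℕ) (m : ℕ) :
    missSum E s (fun _ => 1) t m = missCard E s t m := by
  simp [missSum_eq_sum_filter, missCard]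

theorem linkSum_const_one (E : Finset (Finset ℕ)) (s t : Finset ℕ) (m : ℕ) :
    linkSum E s (fun _ => 1) t m = (#s).choose m - missCard E s t m := by
  have h1 := linkSum_add_missSum E s (fun _ => 1) t m
  have h2 : esum s (fun _ => 1) m = (#s).choose m := by simp [esum]
  rw [missSum_const_one] at h1
  linarith

theorem missCard_mul_le {s t : Finset ℕ} {m : ℕ} {c : ℝ}
    (h : ∀ p ∈ powersetCard m s, c ≤ ∏ i ∈ p, x i) : missCard E s t m * c ≤ missSum E s x t m := by
  rw [missSum_eq_sum_filter, missCard, ← nsmul_eq_mul]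
  exact card_nsmul_le_sum _ _ _ fun p hp => h p (mem_filter.1 hp).1

/-- Comparison of the number of edges through the last two vertices with the number of missing
triples of other types. -/
theorem card_codegree_le {r : ℕ} (hE : E ⊆ powersetCard 3 (range (r + 4)))
    (hc : #E ≤ (r + 3).choose 3 + (r + 2).choose 2) :
    (#{i ∈ range (r + 2) | {r + 2, r + 3} ∪ {i} ∈ E} : ℝ) ≤ missCard E (range (r + 2)) ∅ 3 +
      missCard E (range (r + 2)) {r + 2} 2 + missCard E (range (r + 2)) {r + 3} 2 := by
  have h1 := weightSum_split_last hE fun _ => (1 : ℝ)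
  have h2 : weightSum E (fun _ => (1 : ℝ)) = #E := by simp [weightSum]
  rw [h2, linkSum_one_eq, linkSum_const_one, linkSum_const_one, linkSum_const_one] at h1
  simp only [card_range, one_mul, sum_const, nsmul_eq_mul, mul_one] at h1
  have h3 : (#E : ℝ) ≤ ((r + 3).choose 3 + (r + 2).choose 2 : ℕ) := by exact_mod_cast hc
  rw [show (r + 3).choose 3 = (r + 2).choose 2 + (r + 2).choose 3 from Nat.choose_succ_succ _ _]
    at h3
  push_cast at h3
  linarith

/-- Consequence of the first order condition at the last two vertices. -/
theorem IsOptimal.missCard_sub_mul_le {r : ℕ} (h : IsOptimal (r + 4) M E x)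
    (hpos : ∀ i < r + 4, 0 < x i) (hx : Antitone x) (hE : Compressed E) :
    ((missCard E (range (r + 2)) {r + 3} 2 : ℝ) - missCard E (range (r + 2)) {r + 2} 2) *
        (x r * x (r + 1)) ≤
      (x (r + 2) - x (r + 3)) * linkSum E (range (r + 2)) x {r + 2, r + 3} 1 := by
  have h1 := h.link_last hpos
  have h2 := linkSum_add_missSum E (range (r + 2)) x {r + 2} 2
  have h3 := linkSum_add_missSum E (range (r + 2)) x {r + 3} 2
  -- By compression a pair absent at `r + 2` is also absent at `r + 3`, so the difference of the two
  -- missing sums runs over actual pairs.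
  have hsub : {p ∈ powersetCard 2 (range (r + 2)) | {r + 2} ∪ p ∉ E} ⊆
      {p ∈ powersetCard 2 (range (r + 2)) | {r + 3} ∪ p ∉ E} := by
    intro p hp
    obtain ⟨hp, hn⟩ := mem_filter.1 hp
    refine mem_filter.2 ⟨hp, fun hm => hn ?_⟩
    have hp' : ∀ i ∈ p, i < r + 2 := fun i hi => mem_range.1 ((mem_powersetCard.1 hp).1 hi)
    have := hE _ hm (r + 3) (by simp) (r + 2) (by omega) (by
      simp only [mem_union, mem_singleton]
      rintro (h | h)
      · omega
      · have := hp' _ h; omega)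
    convert this using 1
    ext i
    have := hp' i
    simp only [mem_union, mem_singleton, mem_insert, mem_erase]
    constructor
    · rintro (h | h)
      · exact Or.inl h
      · have := hp' i h
        exact Or.inr ⟨by omega, Or.inr h⟩
    · rintro (h | ⟨h, h' | h'⟩)
      exacts [Or.inl h, absurd h' h, Or.inr h']
  have h4 : missSum E (range (r + 2)) x {r + 3} 2 - missSum E (range (r + 2)) x {r + 2} 2 =
      ∑ p ∈ {p ∈ powersetCard 2 (range (r + 2)) | {r + 3} ∪ p ∉ E} \
        {p ∈ powersetCard 2 (range (r + 2)) | {r + 2} ∪ p ∉ E}, ∏ i ∈ p, x i := by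
    rw [missSum_eq_sum_filter, missSum_eq_sum_filter, ← sum_sdiff hsub]
    ring
  have h5 : ((missCard E (range (r + 2)) {r + 3} 2 : ℝ) - missCard E (range (r + 2)) {r + 2} 2) *
      (x r * x (r + 1)) ≤
      missSum E (range (r + 2)) x {r + 3} 2 - missSum E (range (r + 2)) x {r + 2} 2 := by
    rw [h4, missCard, missCard, ← Nat.cast_sub (card_le_card hsub), ← card_sdiff_of_subset hsub,
      ← nsmul_eq_mul]
    exact card_nsmul_le_sum _ _ _ fun p hp =>
      le_prod_pair hx h.nonneg (mem_filter.1 (mem_sdiff.1 hp).1).1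
  refine h5.trans (le_of_eq ?_)
  linear_combination h1 - h2 + h3

/-- First order condition at the vertices `0` and `i` when all triples through `0` are edges. -/
theorem IsOptimal.sub_mul_eq_missSum {k : ℕ} (h : IsOptimal k M E x) (hpos : ∀ i < k, 0 < x i)
    (h0 : ∀ p ∈ powersetCard 2 ((range k).erase 0), insert 0 p ∈ E) {i : ℕ} (hi : i < k)
    (hi0 : 0 ≠ i) :
    (x 0 - x i) * (1 - x 0 - x i) = missSum E (((range k).erase 0).erase i) x {i} 2 := by
  have h1 := h.link_eq (i := 0) (j := i) (by omega) hi hi0 (hpos 0 (by omega)) (hpos i hi)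
  set s := ((range k).erase 0).erase i with hs
  have e1 : linkSum E s x {0} 2 = esum s x 2 := by
    refine sum_congr rfl fun p hp => if_pos ?_
    rw [← insert_eq]
    exact h0 p (powersetCard_mono (erase_subset _ _) hp)
  have e2 : linkSum E s x {0, i} 1 = ∑ l ∈ s, x l := by
    rw [linkSum_one_eq, filter_true_of_mem]
    intro l hl
    rw [insert_union, ← insert_eq]
    refine h0 _ (mem_powersetCard.2 ⟨insert_subset (by simp [hi, hi0.symm])
      (singleton_subset_iff.2 (erase_subset _ _ hl)), card_pair ?_⟩)
    rintro rfl
    simp [hs] at hl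
  have e3 : ∑ l ∈ s, x l = 1 - x 0 - x i := by
    have h2 := h.sum_eq
    rw [← sum_erase_add _ _ (mem_range.2 (by omega : 0 < k)),
      ← sum_erase_add ((range k).erase 0) _ (a := i) (by simp [hi, hi0.symm])] at h2
    linarith
  rw [e1, e2, e3] at h1
  linear_combination -h1 - linkSum_add_missSum E s x {i} 2

theorem IsOptimal.pos_one_sub {k : ℕ} (h : IsOptimal k M E x) (hpos : ∀ i < k, 0 < x i)
    (hk : 3 ≤ k) {i : ℕ} (hi : i < k) (hi0 : 0 ≠ i) : 0 < 1 - x 0 - x i := by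
  have h2 := h.sum_eq
  rw [← sum_erase_add _ _ (mem_range.2 (by omega : 0 < k)),
    ← sum_erase_add ((range k).erase 0) _ (a := i) (by simp [hi, hi0.symm])] at h2
  have : 0 < ∑ l ∈ ((range k).erase 0).erase i, x l := by
    refine sum_pos (fun l hl => hpos l ?_) ?_
    · simp only [mem_erase, mem_range] at hl
      exact hl.2.2
    · rw [← card_pos, card_erase_of_mem (by simp [hi, hi0.symm]), card_erase_of_mem (by simp; omega),
        card_range]
      omega
  linarith

/-- The case of `r + 4` vertices where all triples of the first `r + 3` vertices are edges. -/
theorem IsOptimal.false_of_clique {r : ℕ} (hr : 2 ≤ r)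
    (h : IsOptimal (r + 4) ((r + 3).choose 3 + (r + 2).choose 2) E x)
    (hpos : ∀ i < r + 4, 0 < x i) (hx : Antitone x) (hE : Compressed E)
    (hcov : {r + 2, r + 3} ∪ {0} ∈ E) (hT : powersetCard 3 (range (r + 3)) ⊆ E) : False := by
  have hb := card_codegree_le h.edges h.card_le
  have hk := h.missCard_sub_mul_le hpos hx hE
  set B := {i ∈ range (r + 2) | {r + 2, r + 3} ∪ {i} ∈ E} with hB
  have m0 : missCard E (range (r + 2)) ∅ 3 = 0 := by
    rw [missCard, card_eq_zero, filter_eq_empty_iff]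
    intro p hp
    rw [not_not, empty_union]
    exact hT (powersetCard_mono (range_subset_range.2 (by omega)) hp)
  have m1 : missCard E (range (r + 2)) {r + 2} 2 = 0 := by
    rw [missCard, card_eq_zero, filter_eq_empty_iff]
    intro p hp
    obtain ⟨hp1, hp2⟩ := mem_powersetCard.1 hp
    rw [not_not, ← insert_eq]
    refine hT (mem_powersetCard.2 ⟨insert_subset (by simp)
      (hp1.trans (range_subset_range.2 (by omega))), ?_⟩)
    rw [card_insert_of_notMem fun hc => by simpa using hp1 hc, hp2]
  rw [m0, m1] at hb
  rw [m1] at hk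
  set H := missCard E (range (r + 2)) {r + 3} 2
  simp only [Nat.cast_zero, zero_add, sub_zero] at hb hk
  have hB0 : 0 < #B := card_pos.2 ⟨0, mem_filter.2 ⟨by simp, hcov⟩⟩
  have hB0' : (0 : ℝ) < #B := by exact_mod_cast hB0
  have hC : linkSum E (range (r + 2)) x {r + 2, r + 3} 1 ≤ #B * x 0 := by
    rw [linkSum_one_eq, ← nsmul_eq_mul]
    exact sum_le_card_nsmul _ _ _ fun i _ => hx (Nat.zero_le i)
  have hwy : x (r + 3) ≤ x (r + 2) := hx (by omega)
  have hqw : x (r + 2) ≤ x (r + 1) := hx (by omega)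
  have hwa : x (r + 2) ≤ x 0 := hx (by omega)
  have hp := hpos r (by omega)
  have hq := hpos (r + 1) (by omega)
  have hw := hpos (r + 2) (by omega)
  have hy := hpos (r + 3) (by omega)
  have h1 : x r * x (r + 2) ≤ x 0 * (x (r + 2) - x (r + 3)) := by
    have : #B * (x r * x (r + 2)) ≤ #B * (x 0 * (x (r + 2) - x (r + 3))) := by
      calc #B * (x r * x (r + 2)) ≤ H * (x r * x (r + 1)) := by gcongr
        _ ≤ _ := hk
        _ ≤ (x (r + 2) - x (r + 3)) * (#B * x 0) :=
          mul_le_mul_of_nonneg_left hC (by linarith)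
        _ = _ := by ring
    exact le_of_mul_le_mul_left this hB0'
  have h2 := h.sub_mul_eq_missSum hpos
    (fun p hp => hE.insert_zero_mem (show 0 < r + 2 by omega) hcov hp) (i := r) (by omega) (by omega)
  have h3 := h.pos_one_sub hpos (by omega) (i := r) (by omega) (by omega)
  set s := ((range (r + 4)).erase 0).erase r with hs
  have hvs : r + 3 ∈ s := by simp [hs]
  have h4 : missSum E s x {r} 2 ≤ x (r + 3) * (1 - x 0 - x r - x (r + 3)) := by
    rw [← insert_erase hvs, missSum_insert (by simp)]
    have e1 : missSum E (s.erase (r + 3)) x {r} 2 = 0 := by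
      refine sum_eq_zero fun p hp => if_pos ?_
      obtain ⟨hp1, hp2⟩ := mem_powersetCard.1 hp
      rw [← insert_eq]
      refine hT (mem_powersetCard.2 ⟨insert_subset (by simp) fun i hi => ?_, ?_⟩)
      · have := hp1 hi
        simp only [hs, mem_erase, mem_range] at this
        exact mem_range.2 (by omega)
      · rw [card_insert_of_notMem fun hc => by simpa [hs] using hp1 hc, hp2]
    have e2 := missSum_le_esum E (s.erase (r + 3)) h.nonneg (insert (r + 3) {r}) 1
    have e3 : ∑ i ∈ s.erase (r + 3), x i = 1 - x 0 - x r - x (r + 3) := by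
      have h5 := h.sum_eq
      rw [← sum_erase_add _ _ (mem_range.2 (by omega : 0 < r + 4)),
        ← sum_erase_add ((range (r + 4)).erase 0) _ (a := r) (by simp; omega),
        ← sum_erase_add s _ hvs] at h5
      linarith
    rw [esum_one, e3] at e2
    rw [e1, zero_add]
    exact mul_le_mul_of_nonneg_left e2 hy.le
  -- Every absent triple through `r` contains `r + 3`, which bounds the gap `x 0 - x r`. But `h1`
  -- gives `x 0 * x (r + 3) ≤ (x 0 - x r) * x (r + 2)`, contradicting `x (r + 2) ≤ x 0`.
  have h5 : x 0 - x r < x (r + 3) := by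
    have : (x 0 - x r) * (1 - x 0 - x r) < x (r + 3) * (1 - x 0 - x r) := by nlinarith
    exact lt_of_mul_lt_mul_right this h3.le
  nlinarith

end TripleSystem

/-! ### Support `r + 4`: the case of an absent triple -/

namespace TripleSystem

variable {M : ℕ} {E : Finset (Finset ℕ)} {x : ℕ → ℝ}

/-- A vertex forming an edge with the last two has the weight of the vertex `0`. -/
theorem IsOptimal.eq_zero_vertex {j : ℕ} (h : IsOptimal (j + 2) M E x)
    (hpos : ∀ i < j + 2, 0 < x i) (hE : Compressed E) {i : ℕ} (hi : i < j)
    (hi' : {j, j + 1} ∪ {i} ∈ E) : x i = x 0 := by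
  rcases eq_or_ne 0 i with rfl | hi0
  · rfl
  have h1 := h.sub_mul_eq_missSum hpos (fun p hp => hE.insert_zero_mem hi hi' hp) (i := i)
    (by omega) hi0
  have h2 := h.pos_one_sub hpos (by omega) (i := i) (by omega) hi0
  have h3 : missSum E (((range (j + 2)).erase 0).erase i) x {i} 2 = 0 := by
    refine sum_eq_zero fun p hp => if_pos ?_
    obtain ⟨hp1, hp2⟩ := mem_powersetCard.1 hp
    obtain ⟨c, d, hcd, rfl⟩ := exists_sorted_pair hp2
    have hc := hp1 (show c ∈ ({c, d} : Finset ℕ) by simp)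
    have hd := hp1 (show d ∈ ({c, d} : Finset ℕ) by simp)
    simp only [mem_erase, mem_range] at hc hd
    have hi'' : ({i, j, j + 1} : Finset ℕ) ∈ E := by
      convert hi' using 1
      ext l
      simp only [mem_insert, mem_singleton, mem_union]
      tauto
    rcases lt_or_gt_of_ne hc.1 with hci | hci
    · rcases lt_or_gt_of_ne hd.1 with hdi | hdi
      · convert hE.mono_triple (a := c) (b := d) (c := i) hcd hdi hi (by omega) (by omega) (by omega)
          (by omega) hi'' using 1
        ext l
        simp only [mem_insert, mem_singleton, mem_union]
        tauto
      · convert hE.mono_triple (a := c) (b := i) (c := d) hci hdi hi (by omega) (by omega) (by omega)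
          (by omega) hi'' using 1
        ext l
        simp only [mem_insert, mem_singleton, mem_union]
        tauto
    · exact hE.mono_triple (a := i) (b := c) (c := d) hci hcd hi (by omega) (by omega) (by omega)
        (by omega) hi''
  rw [h3] at h1
  rcases mul_eq_zero.1 h1 with h1 | h1 <;> linarith

/-- Cauchy–Schwarz on the other `r + 3` weights turns the derivative bound at `0` into `(r + 1) / (r
+ 3) ≤ (1 - x 0)²`; the claim follows from `(r + 1)(r + 3) < (r + 2)²`. -/
theorem IsOptimal.weight_zero_le {r : ℕ} (h : IsOptimal (r + 4) M E x)
    (hpos : ∀ i < r + 4, 0 < x i)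
    (hL : ((r : ℝ) + 2) * (r + 1) / (r + 3) ^ 2 ≤ 6 * weightSum E x) : x 0 ≤ 1 / (r + 2) := by
  have h1 := h.six_mul_weightSum_le hpos (by omega)
  have h2 := sq_sum_le_card_mul_sum_sq (s := (range (r + 4)).erase 0) (f := x)
  have h3 : ∑ i ∈ (range (r + 4)).erase 0, x i = 1 - x 0 := by
    rw [← h.sum_eq, ← sum_erase_add _ _ (mem_range.2 (by omega : 0 < r + 4))]; ring
  have h4 : (#((range (r + 4)).erase 0) : ℝ) = r + 3 := by
    rw [card_erase_of_mem (by simp), card_range]; push_cast; ring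
  rw [h3, h4] at h2
  have hx1 : 0 ≤ 1 - x 0 := by rw [← h3]; exact sum_nonneg fun i _ => h.nonneg i
  set Q := ∑ i ∈ (range (r + 4)).erase 0, x i ^ 2
  have hr : (0 : ℝ) ≤ r := by positivity
  have h5 : ((r : ℝ) + 1) ≤ (r + 3) * (1 - x 0) ^ 2 := by
    have e1 : ((r : ℝ) + 2) * (r + 1) / (r + 3) ^ 2 ≤ (1 - x 0) ^ 2 - Q := hL.trans h1
    rw [div_le_iff₀ (by positivity)] at e1
    have e2 : ((r : ℝ) + 2) * (r + 1) ≤ (r + 2) * ((r + 3) * (1 - x 0) ^ 2) := by nlinarith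
    exact le_of_mul_le_mul_left e2 (by positivity)
  rw [le_div_iff₀ (by positivity)]
  by_contra hc
  push Not at hc
  have e3 : (1 - x 0) * (r + 2) < r + 1 := by linarith
  have e4 : ((1 - x 0) * (r + 2)) ^ 2 < (r + 1 : ℝ) ^ 2 :=
    pow_lt_pow_left₀ e3 (by positivity) (by norm_num)
  nlinarith

theorem mergeLast_sum {j : ℕ} (h : Feasible (j + 2) M E x) :
    ∑ i ∈ range (j + 1), mergeLast x j i = 1 := by
  have := h.mergeLast.sum_eq
  rwa [sum_range_succ, mergeLast_last, add_zero] at this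

theorem weightSum_mergeLast_eq {j : ℕ} (hE : E ⊆ powersetCard 3 (range (j + 2))) :
    weightSum E (mergeLast x j) = linkSum E (range (j + 1)) (mergeLast x j) ∅ 3 := by
  rw [weightSum_eq_linkSum hE, range_add_one, linkSum_insert (by simp), mergeLast_last]
  ring

/-- Multiplying all weights by `n` normalises the uniform weight to `1`. The constants of
`twin_arith` come from `n ≥ 5` and `b ≤ n - 3`: the rescaled largest weight is at most `n / (n - 1)
≤ 5 / 4`, and `K ≥ n - 2 - 1 / 6`. -/
theorem twin_arith_scaled {n b a p q w y : ℝ} (hn : 5 ≤ n) (hb : 1 ≤ b) (hb2 : b ≤ 2 ∨ 3 ≤ b)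
    (hbn : b ≤ n - 3) (ha : a ≤ 1 / (n - 1)) (h1 : p ≤ a) (h2 : q ≤ p) (h3 : w ≤ q) (h4 : y ≤ w)
    (hy : 0 < y) (hex : p * q ≤ a * y)
    (h : 3 * b * (w + y) * (p * q) + ((3 - 4 / n - 2 / (n - 1)) *
        (b * (a - 1 / n) ^ 2 + ((p - 1 / n) ^ 2 + (q - 1 / n) ^ 2)) +
        (3 - 4 / n - 4 / (n + 1)) * (w + y - 1 / n) ^ 2) ≤ 3 * b * a * (w ^ 2 + y ^ 2)) :
    False := by
  have hn0 : 0 < n := by linarith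
  have hn1 : 0 < n - 1 := by linarith
  have hK : n * (3 - 4 / n - 2 / (n - 1)) / 3 = n - 2 - 2 / (3 * (n - 1)) := by
    field_simp; ring
  have hK' : n * (3 - 4 / n - 4 / (n + 1)) / 3 = n - 8 / 3 + 4 / (3 * (n + 1)) := by
    field_simp; ring
  have e1 : 2 / (3 * (n - 1)) ≤ 1 / 6 := by
    rw [div_le_div_iff₀ (by positivity) (by norm_num)]; linarith
  have e2 : 0 ≤ 4 / (3 * (n + 1)) := by positivity
  refine twin_arith (b := b) (K := n * (3 - 4 / n - 2 / (n - 1)) / 3)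
    (K' := n * (3 - 4 / n - 4 / (n + 1)) / 3) (α := n * a) (v₁ := n * p) (v₂ := n * q) (ω := n * w)
    (η := n * y) hb hb2 (by rw [hK]; linarith) (by rw [hK]; linarith) (by rw [hK']; linarith) ?_
    (by gcongr) (by gcongr) (by gcongr) (by gcongr) (by positivity) ?_ ?_
  · rw [le_div_iff₀ hn1] at ha
    nlinarith
  · calc n * p * (n * q) = n ^ 2 * (p * q) := by ring
      _ ≤ n ^ 2 * (a * y) := by gcongr
      _ = _ := by ring
  · have hs : ∀ t : ℝ, (n * t - 1) ^ 2 = n ^ 2 * (t - 1 / n) ^ 2 := fun t => by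
      field_simp
    rw [hs, hs, hs, ← mul_add n w y, hs]
    have := mul_le_mul_of_nonneg_left h (show 0 ≤ n ^ 3 / 3 by positivity)
    linarith

/-- The case of `r + 4` vertices where some triple of the first `r + 3` vertices is not an edge. -/
theorem IsOptimal.false_of_not_clique {r : ℕ} (hr : 2 ≤ r)
    (h : IsOptimal (r + 4) ((r + 3).choose 3 + (r + 2).choose 2) E x)
    (hpos : ∀ i < r + 4, 0 < x i) (hx : Antitone x) (hE : Compressed E)
    (hL : ((r : ℝ) + 2) * (r + 1) / (r + 3) ^ 2 ≤ 6 * weightSum E x)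
    (hcov : {r + 2, r + 3} ∪ {0} ∈ E) {f : Finset ℕ} (hf : f ∈ powersetCard 3 (range (r + 3)))
    (hfE : f ∉ E) : False := by
  have hcard := card_codegree_le h.edges h.card_le
  have hkkt := h.missCard_sub_mul_le hpos hx hE
  have ha1 := h.weight_zero_le hpos hL
  set B := {i ∈ range (r + 2) | {r + 2, r + 3} ∪ {i} ∈ E} with hB
  have hBE : ∀ i ∈ B, i < r + 2 ∧ {r + 2, r + 3} ∪ {i} ∈ E := fun i hi =>
    ⟨mem_range.1 (mem_filter.1 hi).1, (mem_filter.1 hi).2⟩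
  have hBa : ∀ i ∈ B, x i = x 0 := fun i hi =>
    h.eq_zero_vertex hpos hE (hBE i hi).1 (hBE i hi).2
  have hC : linkSum E (range (r + 2)) x {r + 2, r + 3} 1 = #B * x 0 := by
    rw [linkSum_one_eq, sum_congr rfl hBa, sum_const, nsmul_eq_mul]
  -- An edge `{i, r + 2, r + 3}` with `i ≥ r` would dominate every triple of the first `r + 3`
  -- vertices, including the absent `f`.
  have hBr : B ⊆ range r := fun i hi => by
    obtain ⟨hi1, hi2⟩ := hBE i hi
    by_contra hir
    refine hfE ?_
    obtain ⟨hf1, hf2⟩ := mem_powersetCard.1 hf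
    obtain ⟨a, b, c, hab, hbc, rfl⟩ := exists_sorted_triple hf2
    have hc := mem_range.1 (hf1 (show c ∈ ({a, b, c} : Finset ℕ) by simp))
    rw [mem_range] at hir
    refine hE.mono_triple (a' := i) (b' := r + 2) (c' := r + 3) hab hbc hi1 (by omega) (by omega)
      (by omega) (by omega) ?_
    convert hi2 using 1
    ext l
    simp only [mem_insert, mem_singleton, mem_union]
    tauto
  have hB0 : 1 ≤ #B := card_pos.2 ⟨0, mem_filter.2 ⟨by simp, hcov⟩⟩
  have hBr' : #B ≤ r := by simpa using card_le_card hBr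
  have hmerge := h.weightSum_mergeLast hpos
  rw [hC] at hmerge hkkt
  rw [weightSum_mergeLast_eq h.edges] at hmerge
  set x' := mergeLast x (r + 2) with hx'
  have hsplit := linkSum_add_missSum E (range (r + 2 + 1)) x' ∅ 3
  rw [range_add_one, missSum_insert (by simp)] at hsplit
  rw [← range_add_one] at hsplit
  have hx'lt : ∀ i ∈ range (r + 2), x' i = x i := fun i hi => mergeLast_of_lt x (mem_range.1 hi)
  have hx'u : x' (r + 2) = x (r + 2) + x (r + 3) := mergeLast_self x (r + 2)
  rw [missSum_congr hx'lt, missSum_congr hx'lt, hx'u, insert_empty_eq] at hsplit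
  have hn : ((r : ℝ) + 3) ≠ 0 := by positivity
  have hB' := esum_three_eq (s := range (r + 2 + 1)) (x := x') hn (by simp; ring)
    (mergeLast_sum h.toFeasible)
  -- Exchanging the edge `{0, r + 2, r + 3}` for `f` cannot increase the weight; the common factor
  -- `x (r + 2)` cancels.
  have hex : x r * x (r + 1) ≤ x 0 * x (r + 3) := by
    have e1 := h.exchange_le hcov hfE (powersetCard_mono (range_subset_range.2 (by omega)) hf)
    have e2 := le_prod_of_subset_range hx h.nonneg hf
    have e3 : ∏ i ∈ ({r + 2, r + 3} ∪ {0} : Finset ℕ), x i = x 0 * x (r + 2) * x (r + 3) := by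
      rw [← prod_triple x (show 0 < r + 2 by omega) (show r + 2 < r + 3 by omega)]
      congr 1
      ext l
      simp only [mem_insert, mem_singleton, mem_union]
      tauto
    have e4 : x (r + 2) * (x r * x (r + 1)) ≤ x (r + 2) * (x 0 * x (r + 3)) := by linarith
    exact le_of_mul_le_mul_left e4 (hpos _ (by omega))
  have hm1 : missCard E (range (r + 2)) {r + 2} 2 * (x r * x (r + 1)) ≤
      missSum E (range (r + 2)) x {r + 2} 2 :=
    missCard_mul_le fun p hp => le_prod_pair hx h.nonneg hp
  have hm0 : missCard E (range (r + 2)) ∅ 3 * (x r * x (r + 1) * x (r + 2)) ≤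
      missSum E (range (r + 2)) x ∅ 3 :=
    missCard_mul_le fun p hp => le_prod_of_subset_range hx h.nonneg
      (powersetCard_mono (range_subset_range.2 (by omega)) hp)
  have hp0 := hpos r (by omega)
  have hq0 := hpos (r + 1) (by omega)
  have hw0 := hpos (r + 2) (by omega)
  have hy0 := hpos (r + 3) (by omega)
  have hpa : x r ≤ x 0 := hx (by omega)
  have hqp : x (r + 1) ≤ x r := hx (by omega)
  have hwq : x (r + 2) ≤ x (r + 1) := hx (by omega)
  have hyw : x (r + 3) ≤ x (r + 2) := hx (by omega)
  have hr' : (2 : ℝ) ≤ r := by exact_mod_cast hr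
  have hz : x (r + 2) + x (r + 3) ≤ 2 / (r + 4) := by
    have e1 := h.sum_eq
    rw [sum_range_succ, sum_range_succ] at e1
    have e2 : (r + 2) * x (r + 2) ≤ ∑ i ∈ range (r + 2), x i := by
      have := card_nsmul_le_sum (range (r + 2)) x (x (r + 2)) fun i hi =>
        hx (mem_range.1 hi).le
      simpa using this
    rw [le_div_iff₀ (by positivity)]
    nlinarith
  have hdiv : (2 : ℝ) / (r + 2) ≤ 1 / 2 := by
    rw [div_le_div_iff₀ (by positivity) (by norm_num)]; linarith
  have hdiv' : (4 : ℝ) / (r + 3) ≤ 4 / 5 := by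
    rw [div_le_div_iff₀ (by positivity) (by norm_num)]; linarith
  have hterm : ∀ i < r + 2, (3 - 4 / ((r : ℝ) + 3) - 2 / (r + 2)) * (x i - 1 / (r + 3)) ^ 2 ≤
      (x' i - 1 / (r + 3)) ^ 2 * (3 - 4 / (r + 3) - 2 * x' i) := fun i hi => by
    rw [hx'lt i (mem_range.2 hi), mul_comm]
    have e1 : x i ≤ 1 / (r + 2) := (hx (Nat.zero_le i)).trans ha1
    have e2 : 2 / ((r : ℝ) + 2) = 2 * (1 / (r + 2)) := by ring
    refine mul_le_mul_of_nonneg_left ?_ (sq_nonneg _)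
    linarith
  have hκ : 0 ≤ 3 - 4 / ((r : ℝ) + 3) - 2 / (r + 2) := by linarith
  have hsum : (3 - 4 / ((r : ℝ) + 3) - 2 / (r + 2)) * (#B * (x 0 - 1 / (r + 3)) ^ 2 +
      ((x r - 1 / (r + 3)) ^ 2 + (x (r + 1) - 1 / (r + 3)) ^ 2)) +
      (3 - 4 / (r + 3) - 4 / (r + 4)) * (x (r + 2) + x (r + 3) - 1 / (r + 3)) ^ 2 ≤
      ∑ i ∈ range (r + 2 + 1), (x' i - 1 / (r + 3)) ^ 2 * (3 - 4 / (r + 3) - 2 * x' i) := by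
    rw [sum_range_succ, sum_range_succ, sum_range_succ, hx'u]
    have e1 := hterm r (by omega)
    have e2 := hterm (r + 1) (by omega)
    have e3 : (3 - 4 / ((r : ℝ) + 3) - 4 / (r + 4)) *
        (x (r + 2) + x (r + 3) - 1 / (r + 3)) ^ 2 ≤
        (x (r + 2) + x (r + 3) - 1 / (r + 3)) ^ 2 *
          (3 - 4 / (r + 3) - 2 * (x (r + 2) + x (r + 3))) := by
      rw [mul_comm]
      have e2 : 4 / ((r : ℝ) + 4) = 2 * (2 / (r + 4)) := by ring
      refine mul_le_mul_of_nonneg_left ?_ (sq_nonneg _)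
      linarith
    have e4 : (3 - 4 / ((r : ℝ) + 3) - 2 / (r + 2)) * (#B * (x 0 - 1 / (r + 3)) ^ 2) ≤
        ∑ i ∈ range r, (x' i - 1 / (r + 3)) ^ 2 * (3 - 4 / (r + 3) - 2 * x' i) := by
      calc _ = ∑ i ∈ B, (3 - 4 / ((r : ℝ) + 3) - 2 / (r + 2)) * (x i - 1 / (r + 3)) ^ 2 := by
            rw [sum_congr rfl fun i hi => by rw [hBa i hi], sum_const, nsmul_eq_mul]; ring
        _ ≤ ∑ i ∈ range r, (3 - 4 / ((r : ℝ) + 3) - 2 / (r + 2)) * (x i - 1 / (r + 3)) ^ 2 :=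
            sum_le_sum_of_subset_of_nonneg hBr fun i _ _ => mul_nonneg hκ (sq_nonneg _)
        _ ≤ _ := sum_le_sum fun i hi => hterm i (by have := mem_range.1 hi; omega)
    linarith
  set S := ∑ i ∈ range (r + 2 + 1), (x' i - 1 / ((r : ℝ) + 3)) ^ 2 * (3 - 4 / (r + 3) - 2 * x' i)
  set t := (missCard E (range (r + 2)) {r + 2} 2 : ℝ)
  set c := (missCard E (range (r + 2)) {r + 3} 2 : ℝ)
  set t₀ := (missCard E (range (r + 2)) ∅ 3 : ℝ)
  set ϖ := x r * x (r + 1) with hϖ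
  set b := (#B : ℝ) with hb
  set z := x (r + 2) + x (r + 3) with hzdef
  have hϖ0 : 0 < ϖ := mul_pos hp0 hq0
  -- The loss from merging must cover both the deficit `S` of the merged weighting from the uniform
  -- one and the weight of the absent triples, since the optimum is at least `L`.
  have hS : S + (6 * t + 3 * t₀) * z * ϖ ≤ 6 * x (r + 3) ^ 2 * (b * x 0) := by
    have e1 : z * (t * ϖ) ≤ z * missSum E (range (r + 2)) x {r + 2} 2 := by gcongr
    have e2 : t₀ * (ϖ * (z / 2)) ≤ t₀ * (ϖ * x (r + 2)) := by
      have : z / 2 ≤ x (r + 2) := by linarith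
      gcongr
    have e3 : ((r : ℝ) + 3 - 1) * (r + 3 - 2) / (r + 3) ^ 2 = (r + 2) * (r + 1) / (r + 3) ^ 2 := by
      congr 1; ring
    rw [e3] at hB'
    linarith
  -- Adding `3 * z` times the first-order condition, with `b ≤ t₀ + t + c`, cancels `t` and `t₀`.
  have hchain : 3 * b * z * ϖ + S ≤ 3 * b * x 0 * (x (r + 2) ^ 2 + x (r + 3) ^ 2) := by
    have e1 : (b - 2 * t - t₀) * ϖ ≤ (x (r + 2) - x (r + 3)) * (b * x 0) := by
      exact (mul_le_mul_of_nonneg_right (by linarith) hϖ0.le).trans hkkt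
    have e2 : 3 * z * ((b - 2 * t - t₀) * ϖ) ≤ 3 * z * ((x (r + 2) - x (r + 3)) * (b * x 0)) := by
      gcongr
    have e3 : 3 * z * ((x (r + 2) - x (r + 3)) * (b * x 0)) + 6 * x (r + 3) ^ 2 * (b * x 0) =
        3 * b * x 0 * (x (r + 2) ^ 2 + x (r + 3) ^ 2) := by rw [hzdef]; ring
    linarith
  have hb1 : (1 : ℝ) ≤ b := by rw [hb]; exact_mod_cast hB0
  have hb2 : b ≤ 2 ∨ 3 ≤ b := by
    rw [hb]
    rcases le_or_gt #B 2 with h2 | h2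
    · left; exact_mod_cast h2
    · right; exact_mod_cast Nat.succ_le_of_lt h2
  have hb3 : b ≤ r := by rw [hb]; exact_mod_cast hBr'
  refine twin_arith_scaled (n := r + 3) (b := b) (a := x 0) (p := x r) (q := x (r + 1))
    (w := x (r + 2)) (y := x (r + 3)) (by linarith) hb1 hb2 (by linarith) ?_ hpa hqp hwq hyw hy0
    hex ?_
  · rwa [show (r : ℝ) + 3 - 1 = r + 2 by ring]
  · rw [show (r : ℝ) + 3 - 1 = r + 2 by ring, show (r : ℝ) + 3 + 1 = r + 4 by ring]
    linarith

/-- Optimal compressed families on `r + 4` vertices do not cover the last two vertices. -/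
theorem IsOptimal.not_covered {r : ℕ} (hr : 2 ≤ r)
    (h : IsOptimal (r + 4) ((r + 3).choose 3 + (r + 2).choose 2) E x)
    (hpos : ∀ i < r + 4, 0 < x i) (hx : Antitone x) (hE : Compressed E)
    (hL : ((r : ℝ) + 2) * (r + 1) / (r + 3) ^ 2 ≤ 6 * weightSum E x) {i : ℕ} (hi : i < r + 2) :
    {r + 2, r + 3} ∪ {i} ∉ E := by
  intro hiE
  have hcov : {r + 2, r + 3} ∪ {0} ∈ E := by
    have := hE.insert_zero_mem hi hiE (p := {r + 2, r + 3})
      (mem_powersetCard.2 ⟨fun l hl => by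
        simp only [mem_insert, mem_singleton, mem_erase, mem_range] at hl ⊢
        omega, card_pair (by omega)⟩)
    rwa [insert_eq, union_comm] at this
  by_cases hT : powersetCard 3 (range (r + 3)) ⊆ E
  · exact h.false_of_clique hr hpos hx hE hcov hT
  · obtain ⟨f, hf, hfE⟩ := not_subset.1 hT
    exact h.false_of_not_clique hr hpos hx hE hL hcov hf hfE

end TripleSystem

/-! ### Extracting a clique from an optimal pair -/

namespace TripleSystem

variable {N : ℕ} {E : Finset (Finset ℕ)} {x : ℕ → ℝ}

/-- The cubic symmetric sum reaches its maximum only at the uniform weighting. -/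
theorem eq_uniform_of_le_esum {r : ℕ} (hr : 2 ≤ r) (hx : ∀ i, 0 ≤ x i)
    (hs : ∑ i ∈ range (r + 3), x i = 1)
    (h : ((r : ℝ) + 2) * (r + 1) / (r + 3) ^ 2 ≤ 6 * esum (range (r + 3)) x 3) :
    (∀ i < r + 3, x i = 1 / (r + 3)) ∧
      6 * esum (range (r + 3)) x 3 = ((r : ℝ) + 2) * (r + 1) / (r + 3) ^ 2 := by
  have hr' : (2 : ℝ) ≤ r := by exact_mod_cast hr
  have h1 := esum_three_eq (s := range (r + 3)) (x := x) (n := r + 3) (by positivity) (by simp) hs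
  rw [show ((r : ℝ) + 3 - 1) * (r + 3 - 2) = (r + 2) * (r + 1) by ring] at h1
  have hdiv : (4 : ℝ) / (r + 3) ≤ 4 / 5 := by
    rw [div_le_div_iff₀ (by positivity) (by norm_num)]; linarith
  -- As `n = r + 3 ≥ 5` and `x i ≤ 1`, the factor is at least `3 - 4 / 5 - 2 > 0`, so the deficit
  -- vanishes only at the uniform point.
  have hpos : ∀ i ∈ range (r + 3), 0 < 3 - 4 / ((r : ℝ) + 3) - 2 * x i := fun i hi => by
    have : x i ≤ 1 := by
      rw [← hs]; exact single_le_sum (fun l _ => hx l) hi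
    linarith
  have hnn : ∀ i ∈ range (r + 3), 0 ≤ (x i - 1 / ((r : ℝ) + 3)) ^ 2 *
      (3 - 4 / (r + 3) - 2 * x i) := fun i hi => mul_nonneg (sq_nonneg _) (hpos i hi).le
  have h0 : ∑ i ∈ range (r + 3), (x i - 1 / ((r : ℝ) + 3)) ^ 2 * (3 - 4 / (r + 3) - 2 * x i) = 0 :=
    le_antisymm (by linarith) (sum_nonneg hnn)
  refine ⟨fun i hi => ?_, by rw [h1, h0, sub_zero]⟩
  have h2 := (sum_eq_zero_iff_of_nonneg hnn).1 h0 i (mem_range.2 hi)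
  rcases mul_eq_zero.1 h2 with h3 | h3
  · have := pow_eq_zero_iff (two_ne_zero) |>.1 h3
    linarith
  · exact absurd h3 (hpos i (mem_range.2 hi)).ne'

/-- `E` contains all triples of some set of `n` vertices. -/
def HasClique {α : Type*} (E : Finset (Finset α)) (n : ℕ) : Prop :=
  ∃ S : Finset α, #S = n ∧ ∀ e : Finset α, e ⊆ S → #e = 3 → e ∈ E

theorem weightSum_powersetCard (s : Finset ℕ) (x : ℕ → ℝ) (r : ℕ) :
    weightSum (powersetCard r s) x = esum s x r := rfl

theorem hasClique_of_small_support {r M : ℕ} (hr : 2 ≤ r) (h : Feasible N M E x)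
    (hz : ∀ i, r + 3 ≤ i → x i = 0)
    (hL : ((r : ℝ) + 2) * (r + 1) / (r + 3) ^ 2 ≤ 6 * weightSum E x) :
    6 * weightSum E x = ((r : ℝ) + 2) * (r + 1) / (r + 3) ^ 2 ∧ HasClique E (r + 3) := by
  have hsum : ∑ i ∈ range (r + 3), x i = 1 := by
    rw [← h.sum_eq]
    rcases le_total (r + 3) N with hN | hN
    · exact sum_subset (range_subset_range.2 hN) fun i _ hi => hz i (by simpa using hi)
    · exact (sum_subset (range_subset_range.2 hN) fun i _ hi => h.zero i (by simpa using hi)).symm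
  have hsub : {e ∈ E | e ⊆ range (r + 3)} ⊆ powersetCard 3 (range (r + 3)) := fun e he =>
    mem_powersetCard.2 ⟨(mem_filter.1 he).2, (mem_powersetCard.1 (h.edges (mem_filter.1 he).1)).2⟩
  have hw := weightSum_filter_of_zero (E := E) hz
  have hle := weightSum_mono hsub h.nonneg
  rw [hw, weightSum_powersetCard] at hle
  obtain ⟨hu, he⟩ := eq_uniform_of_le_esum hr h.nonneg hsum (by linarith)
  refine ⟨by linarith, range (r + 3), by simp, fun f hf hf3 => ?_⟩
  by_contra hfE
  have hf' : f ∈ powersetCard 3 (range (r + 3)) \ {e ∈ E | e ⊆ range (r + 3)} :=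
    mem_sdiff.2 ⟨mem_powersetCard.2 ⟨hf, hf3⟩, fun h => hfE (mem_filter.1 h).1⟩
  have h1 : weightSum {e ∈ E | e ⊆ range (r + 3)} x < esum (range (r + 3)) x 3 := by
    rw [← weightSum_powersetCard]
    refine sum_lt_sum_of_subset hsub (mem_sdiff.1 hf').1 (mem_sdiff.1 hf').2
      (prod_pos fun i hi => ?_) fun _ _ _ => prod_nonneg fun i _ => h.nonneg i
    rw [hu i (mem_range.1 (hf hi))]
    positivity
  linarith

/-- If the optimal weighting is uniform up to splitting one vertex, the family contains the twin
graph. -/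
theorem twinGraph_subset {r : ℕ} (hN : r + 4 ≤ N)
    (h : IsOptimal N ((r + 3).choose 3 + (r + 2).choose 2) E x) (hx : Antitone x)
    (hz : ∀ i, r + 4 ≤ i → x i = 0) (hu : ∀ i < r + 2, x i = 1 / (r + 3))
    (hwy : x (r + 2) + x (r + 3) = 1 / (r + 3)) (hy : 0 < x (r + 3)) : twinGraph r ⊆ E := by
  by_contra hne
  obtain ⟨f, hf, hfE⟩ := not_subset.1 hne
  have hF : Feasible N ((r + 3).choose 3 + (r + 2).choose 2) (twinGraph r) x :=
    ⟨(filter_subset _ _).trans (powersetCard_mono (range_subset_range.2 hN)),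
      (card_twinGraph r).le, h.nonneg, h.zero, h.sum_eq⟩
  have h1 := h.max _ _ hF
  have hcard : #(E \ twinGraph r) ≤ #(twinGraph r \ E) :=
    card_sdiff_le_card_sdiff_iff.2 (by rw [card_twinGraph]; exact h.card_le)
  have hpos : 0 < #(twinGraph r \ E) := card_pos.2 ⟨f, mem_sdiff.2 ⟨hf, hfE⟩⟩
  set c : ℝ := 1 / (r + 3) with hc
  have hc0 : 0 < c := by positivity
  have hlow : #(twinGraph r \ E) * (c * c * x (r + 3)) ≤ weightSum (twinGraph r \ E) x := by
    rw [← nsmul_eq_mul]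
    refine card_nsmul_le_sum _ _ _ fun e he => ?_
    have := le_prod_of_mem_twinGraph hx h.nonneg (mem_sdiff.1 he).1
    rwa [hu r (by omega), hu (r + 1) (by omega)] at this
  have hup : weightSum (E \ twinGraph r) x ≤ #(E \ twinGraph r) * (c * x (r + 2) * x (r + 3)) := by
    rw [← nsmul_eq_mul]
    refine sum_le_card_nsmul _ _ _ fun e he => ?_
    obtain ⟨he, het⟩ := mem_sdiff.1 he
    have he3 := (mem_powersetCard.1 (h.edges he)).2
    obtain ⟨i, j, k, hij, hjk, rfl⟩ := exists_sorted_triple he3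
    rw [prod_triple x hij hjk]
    have hw := h.nonneg (r + 2)
    rcases le_or_gt (r + 4) k with hk | hk
    · rw [hz k hk, mul_zero]
      positivity
    · have hj : j = r + 2 ∧ k = r + 3 := by
        by_contra hn
        refine het (mem_filter.2 ⟨mem_powersetCard.2 ⟨fun l hl => ?_, he3⟩, fun hl => ?_⟩)
        · simp only [mem_insert, mem_singleton, mem_range] at hl ⊢
          omega
        · simp only [mem_insert, mem_singleton] at hl
          omega
      obtain ⟨rfl, rfl⟩ := hj
      rw [hu i hij]
  have e1 : weightSum (twinGraph r \ E) x ≤ weightSum (E \ twinGraph r) x := by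
    unfold weightSum at h1 ⊢
    rw [← sum_inter_add_sum_sdiff (twinGraph r) E, ← sum_inter_add_sum_sdiff E (twinGraph r),
      inter_comm] at h1
    linarith
  -- Because `x (r + 3) > 0`, a triple containing both twins weighs strictly less than any twin
  -- triple, so an absent twin triple would contradict optimality.
  have hw : x (r + 2) < c := by linarith
  have hcard' : (#(E \ twinGraph r) : ℝ) ≤ #(twinGraph r \ E) := by exact_mod_cast hcard
  have hpos' : (0 : ℝ) < #(twinGraph r \ E) := by exact_mod_cast hpos
  have e2 : (#(E \ twinGraph r) : ℝ) * (c * x (r + 2) * x (r + 3)) ≤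
      #(twinGraph r \ E) * (c * x (r + 2) * x (r + 3)) := by
    have := h.nonneg (r + 2)
    gcongr
  have e3 : (#(twinGraph r \ E) : ℝ) * (c * x (r + 2) * x (r + 3)) <
      #(twinGraph r \ E) * (c * c * x (r + 3)) := by gcongr
  linarith

/-- An optimal pair with value at least that of the complete system on `r + 3` vertices has exactly
this value and contains a clique on `r + 3` vertices. -/
theorem IsOptimal.hasClique_of_antitone {r : ℕ} (hr : 2 ≤ r)
    (h : IsOptimal N ((r + 3).choose 3 + (r + 2).choose 2) E x) (hx : Antitone x)
    (hL : ((r : ℝ) + 2) * (r + 1) / (r + 3) ^ 2 ≤ 6 * weightSum E x) :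
    6 * weightSum E x = ((r : ℝ) + 2) * (r + 1) / (r + 3) ^ 2 ∧ HasClique E (r + 3) := by
  classical
  have hex : ∃ k, x k = 0 := ⟨N, h.zero N le_rfl⟩
  obtain ⟨k, hk0, hkmin⟩ : ∃ k, x k = 0 ∧ ∀ i < k, x i ≠ 0 :=
    ⟨Nat.find hex, Nat.find_spec hex, fun i hi => Nat.find_min hex hi⟩
  have hkN : k ≤ N := by
    by_contra hc
    exact hkmin N (by omega) (h.zero N le_rfl)
  have hpos : ∀ i < k, 0 < x i := fun i hi => lt_of_le_of_ne (h.nonneg i) (hkmin i hi).symm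
  have hz : ∀ i, k ≤ i → x i = 0 := fun i hi => le_antisymm (hk0 ▸ hx hi) (h.nonneg i)
  rcases le_or_gt k (r + 3) with hk | hk
  · exact hasClique_of_small_support hr h.toFeasible (fun i hi => hz i (hk.trans hi)) hL
  obtain ⟨E', hopt, hcomp, hw⟩ := h.exists_compressed hx
  have hopt' := hopt.restrict hkN hz
  have hcomp' := hcomp.filter_range k
  have hw' := weightSum_filter_of_zero (E := E') hz
  set F := {e ∈ E' | e ⊆ range k}
  rw [← hw, ← hw'] at hL ⊢
  rcases le_or_gt (r + 5) k with hk5 | hk5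
  · obtain ⟨j, rfl⟩ : ∃ j, k = j + 2 := ⟨k - 2, by omega⟩
    exact (hopt'.false_of_large_support hr (by omega) hpos hx hcomp' hL).elim
  obtain rfl : k = r + 4 := by omega
  have hnc := fun i hi => hopt'.not_covered hr hpos hx hcomp' hL (i := i) hi
  have hC : linkSum F (range (r + 2)) x {r + 2, r + 3} 1 = 0 := by
    rw [linkSum_one_eq, filter_false_of_mem fun i hi => hnc i (mem_range.1 hi), sum_empty]
  have hm := hopt'.weightSum_mergeLast hpos
  rw [hC, mul_zero, sub_zero, weightSum_mergeLast_eq hopt'.edges] at hm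
  have hle := linkSum_le_esum F (range (r + 2 + 1)) hopt'.toFeasible.mergeLast.nonneg ∅ 3
  obtain ⟨hu, he⟩ := eq_uniform_of_le_esum hr hopt'.toFeasible.mergeLast.nonneg
    (mergeLast_sum hopt'.toFeasible) (hL.trans (by rw [← hm]; linarith))
  refine ⟨le_antisymm (by linarith) hL, ?_⟩
  -- Compression only served to determine `x`; the conclusion is drawn for the original `E`, which
  -- is optimal for the same `x`.
  have hsub : twinGraph r ⊆ E := by
    refine twinGraph_subset hkN h hx hz (fun i hi => ?_) ?_ (hpos _ (by omega))
    · rw [← hu i (by omega), mergeLast_of_lt x hi]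
    · rw [← hu (r + 2) (by omega), mergeLast_self]
  refine ⟨range (r + 3), by simp, fun f hf hf3 => hsub (mem_filter.2 ⟨mem_powersetCard.2
    ⟨hf.trans (range_subset_range.2 (by omega)), hf3⟩, fun hl => ?_⟩)⟩
  simpa using hf hl.2

end TripleSystem

/-! ### Existence of optimal pairs and relabelling -/

namespace TripleSystem

variable {N M : ℕ} {E : Finset (Finset ℕ)} {x : ℕ → ℝ}

/-- The image of a family of finite sets under an injection. -/
def mapFamily {α β : Type*} (φ : α ↪ β) (E : Finset (Finset α)) : Finset (Finset β) :=
  E.map (mapEmbedding φ).toEmbedding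

theorem mem_mapFamily {α β : Type*} {φ : α ↪ β} {E : Finset (Finset α)} {f : Finset β} :
    f ∈ mapFamily φ E ↔ ∃ e ∈ E, e.map φ = f := by
  simp [mapFamily]

/-- With `3 ≤ n` every clique vertex lies in an edge of the image, hence in the range of `φ`, and
the clique pulls back. -/
theorem HasClique.of_mapFamily {α β : Type*} {φ : α ↪ β} {E : Finset (Finset α)} {n : ℕ}
    (hn : 3 ≤ n) (h : HasClique (mapFamily φ E) n) : HasClique E n := by
  classical
  obtain ⟨S, hS, hSE⟩ := h
  set T := S.preimage φ φ.injective.injOn with hT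
  have hTS : T.map φ = S := by
    ext s
    simp only [mem_map, hT, mem_preimage]
    refine ⟨?_, fun hs => ?_⟩
    · rintro ⟨a, ha, rfl⟩
      exact ha
    · obtain ⟨f, hsf, hfS, hf3⟩ := exists_subsuperset_card_eq (singleton_subset_iff.2 hs)
        (show #{s} ≤ 3 by simp) (hS ▸ hn)
      obtain ⟨e, -, rfl⟩ := mem_mapFamily.1 (hSE f hfS hf3)
      obtain ⟨a, -, rfl⟩ := mem_map.1 (hsf (mem_singleton_self s))
      exact ⟨a, hs, rfl⟩
  refine ⟨T, by rw [← hS, ← hTS, card_map], fun e he he3 => ?_⟩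
  obtain ⟨e', he', heq⟩ := mem_mapFamily.1 (hSE (e.map φ) (hTS ▸ map_subset_map.2 he)
    (by rw [card_map, he3]))
  rwa [← map_injective φ heq]

theorem weightSum_mapFamily {α : Type*} (φ : α ↪ ℕ) (E : Finset (Finset α)) (x : ℕ → ℝ) :
    weightSum (mapFamily φ E) x = ∑ e ∈ E, ∏ i ∈ e, x (φ i) := by
  simp [weightSum, mapFamily]

/-- The weightings form a compact subset of a product of unit intervals, and only finitely many
families compete. -/
theorem exists_isOptimal (h : Feasible N M E x) : ∃ E' x', IsOptimal N M E' x' := by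
  classical
  have hcont : ∀ F : Finset (Finset ℕ), Continuous (weightSum F) := fun F => by
    unfold weightSum
    fun_prop
  set Δ : Set (ℕ → ℝ) := {x | (∀ i, 0 ≤ x i) ∧ (∀ i, N ≤ i → x i = 0) ∧ ∑ i ∈ range N, x i = 1}
    with hΔ
  have hclosed : IsClosed Δ := by
    refine IsClosed.and ?_ (IsClosed.and ?_ ?_)
    · simp only [Set.ofPred_forall]
      exact isClosed_iInter fun i => isClosed_le continuous_const (continuous_apply i)
    · simp only [Set.ofPred_forall]
      exact isClosed_iInter fun i => isClosed_iInter fun _ =>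
        isClosed_eq (continuous_apply i) continuous_const
    · exact isClosed_eq (by fun_prop) continuous_const
  have hcomp : IsCompact Δ := by
    refine (isCompact_univ_pi fun _ : ℕ => isCompact_Icc (a := (0 : ℝ)) (b := 1)).of_isClosed_subset
      hclosed fun x hx i _ => ⟨hx.1 i, ?_⟩
    rcases lt_or_ge i N with hi | hi
    · rw [← hx.2.2]
      exact single_le_sum (fun l _ => hx.1 l) (mem_range.2 hi)
    · rw [hx.2.1 i hi]
      exact zero_le_one
  have hne : Δ.Nonempty := ⟨x, h.nonneg, h.zero, h.sum_eq⟩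
  choose f hfΔ hfmax using fun F : Finset (Finset ℕ) =>
    hcomp.exists_isMaxOn hne (hcont F).continuousOn
  obtain ⟨F, hF, hFmax⟩ := exists_max_image
    {F ∈ (powersetCard 3 (range N)).powerset | #F ≤ M} (fun F => weightSum F (f F))
    ⟨E, mem_filter.2 ⟨mem_powerset.2 h.edges, h.card_le⟩⟩
  obtain ⟨hF1, hF2⟩ := mem_filter.1 hF
  refine ⟨F, f F, ⟨mem_powerset.1 hF1, hF2, (hfΔ F).1, (hfΔ F).2.1, (hfΔ F).2.2⟩,
    fun E' x' h' => ?_⟩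
  exact (hfmax E' ⟨h'.nonneg, h'.zero, h'.sum_eq⟩).trans
    (hFmax E' (mem_filter.2 ⟨mem_powerset.2 h'.edges, h'.card_le⟩))

theorem exists_sorting_perm (x : ℕ → ℝ) (hx : ∀ i, 0 ≤ x i) (hz : ∀ i, N ≤ i → x i = 0) :
    ∃ π : Equiv.Perm ℕ, (∀ i, π i < N ↔ i < N) ∧ Antitone (x ∘ π) := by
  set σ := Tuple.sort fun i : Fin N => -x i with hσ
  have hmono : Monotone ((fun i : Fin N => -x i) ∘ σ) := Tuple.monotone_sort _
  set π := σ.extendDomain (Fin.equivSubtype (n := N)) with hπ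
  have h1 : ∀ i (hi : i < N), π i = σ ⟨i, hi⟩ := fun i hi => by
    have := σ.extendDomain_apply_image (Fin.equivSubtype (n := N)) ⟨i, hi⟩
    simpa using this
  have h2 : ∀ i, ¬ i < N → π i = i := fun i hi =>
    σ.extendDomain_apply_not_subtype (Fin.equivSubtype (n := N)) hi
  refine ⟨π, fun i => ?_, fun i j hij => ?_⟩
  · by_cases hi : i < N
    · simp only [h1 i hi, hi, iff_true]
      exact (σ ⟨i, hi⟩).2
    · rw [h2 i hi]
  · simp only [Function.comp]
    by_cases hj : j < N
    · have hi : i < N := by omega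
      rw [h1 i hi, h1 j hj]
      have := hmono (show (⟨i, hi⟩ : Fin N) ≤ ⟨j, hj⟩ from hij)
      simpa using this
    · rw [h2 j hj, hz j (by omega)]
      exact hx _

theorem IsOptimal.hasClique {r : ℕ} (hr : 2 ≤ r)
    (h : IsOptimal N ((r + 3).choose 3 + (r + 2).choose 2) E x)
    (hL : ((r : ℝ) + 2) * (r + 1) / (r + 3) ^ 2 ≤ 6 * weightSum E x) :
    6 * weightSum E x = ((r : ℝ) + 2) * (r + 1) / (r + 3) ^ 2 ∧ HasClique E (r + 3) := by
  obtain ⟨π, hπN, hπ⟩ := exists_sorting_perm x h.nonneg h.zero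
  have hw : weightSum (mapFamily π.symm.toEmbedding E) (x ∘ π) = weightSum E x := by
    rw [weightSum_mapFamily]
    simp [weightSum]
  have hπN' : ∀ i, π.symm i < N ↔ i < N := fun i => by
    rw [← hπN (π.symm i), Equiv.apply_symm_apply]
  have hF : Feasible N ((r + 3).choose 3 + (r + 2).choose 2) (mapFamily π.symm.toEmbedding E)
      (x ∘ π) := by
    refine ⟨fun f hf => ?_, ?_, fun i => h.nonneg _, fun i hi => h.zero _ ?_, ?_⟩
    · obtain ⟨e, he, rfl⟩ := mem_mapFamily.1 hf
      obtain ⟨he1, he2⟩ := mem_powersetCard.1 (h.edges he)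
      refine mem_powersetCard.2 ⟨fun i hi => ?_, by rw [card_map, he2]⟩
      obtain ⟨l, hl, rfl⟩ := mem_map.1 hi
      exact mem_range.2 ((hπN' l).2 (mem_range.1 (he1 hl)))
    · rw [mapFamily, card_map]
      exact h.card_le
    · have := hπN i
      omega
    · rw [← h.sum_eq]
      exact sum_equiv π (fun i => by simp [hπN i]) fun i _ => rfl
  have hopt : IsOptimal N ((r + 3).choose 3 + (r + 2).choose 2) (mapFamily π.symm.toEmbedding E)
      (x ∘ π) := ⟨hF, fun E' x' h' => hw ▸ h.max E' x' h'⟩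
  have := hopt.hasClique_of_antitone hr hπ (by rwa [hw])
  rw [hw] at this
  exact ⟨this.1, this.2.of_mapFamily (by omega)⟩

theorem Feasible.hasClique {r : ℕ} (hr : 2 ≤ r)
    (h : Feasible N ((r + 3).choose 3 + (r + 2).choose 2) E x)
    (hL : ((r : ℝ) + 2) * (r + 1) / (r + 3) ^ 2 ≤ 6 * weightSum E x) : HasClique E (r + 3) := by
  obtain ⟨E', x', hopt⟩ := exists_isOptimal h
  have h1 := hopt.max E x h
  have h2 := hopt.hasClique hr (by linarith)
  -- The optimum is exactly `L`, so a feasible pair reaching `L` is itself optimal and the clique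
  -- lies in its own family.
  refine (IsOptimal.hasClique hr ⟨h, fun E'' x'' h'' => ?_⟩ hL).2
  have := hopt.max E'' x'' h''
  linarith [h2.1]

end TripleSystem

/-! ### Return to 3-graphs on an arbitrary finite vertex set -/

namespace UniformGraph

open TripleSystem

theorem lagrangianAt_lt_of_not_containsClique {V : Type*} [Fintype V] {r : ℕ} (hr : 2 ≤ r)
    (G : UniformGraph V 3) (hG : #G.edges ≤ (r + 3).choose 3 + (r + 2).choose 2)
    (hclique : ¬ G.ContainsClique (r + 3)) {x : V → ℝ} (hx : x ∈ stdSimplex ℝ V) :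
    6 * G.lagrangianAt x < ((r : ℝ) + 2) * (r + 1) / (r + 3) ^ 2 := by
  by_contra hL
  push Not at hL
  set N := Fintype.card V
  set σ := Fintype.equivFin V
  set φ : V ↪ ℕ := σ.toEmbedding.trans Fin.valEmbedding with hφ
  set y : ℕ → ℝ := fun i => if h : i < N then x (σ.symm ⟨i, h⟩) else 0 with hy
  have hyφ : ∀ v, y (φ v) = x v := fun v => by simp [hy, hφ, N]
  have hφN : ∀ v, φ v < N := fun v => (σ v).2
  have hw : weightSum (mapFamily φ G.edges) y = G.lagrangianAt x := by
    rw [weightSum_mapFamily]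
    simp only [hyφ]
    rfl
  have hF : Feasible N ((r + 3).choose 3 + (r + 2).choose 2) (mapFamily φ G.edges) y := by
    refine ⟨fun f hf => ?_, ?_, fun i => ?_, fun i hi => ?_, ?_⟩
    · obtain ⟨e, he, rfl⟩ := mem_mapFamily.1 hf
      refine mem_powersetCard.2 ⟨fun i hi => ?_, by rw [card_map, G.card_edge e he]⟩
      obtain ⟨v, -, rfl⟩ := mem_map.1 hi
      exact mem_range.2 (hφN v)
    · rwa [mapFamily, card_map]
    · simp only [hy]
      split_ifs
      exacts [hx.1 _, le_rfl]
    · simp only [hy]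
      rw [dif_neg (by omega)]
    · rw [← hx.2, ← Fin.sum_univ_eq_sum_range y N, ← Equiv.sum_comp σ]
      exact sum_congr rfl fun v _ => hyφ v
  exact hclique ((hF.hasClique hr (by rwa [hw])).of_mapFamily (by omega))

end UniformGraph

namespace UniformGraph

/-- Evaluation at the uniform weighting; only this lower bound on the clique's Lagrangian is needed.
-/
theorem le_lagrangian_complete (r : ℕ) :
    ((r : ℝ) + 2) * (r + 1) / (r + 3) ^ 2 ≤ 6 * (complete (Fin (r + 3)) 3).lagrangian := by
  have hmem : (fun _ => 1 / ((r : ℝ) + 3)) ∈ stdSimplex ℝ (Fin (r + 3)) := by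
    refine ⟨fun _ => by positivity, ?_⟩
    simp only [sum_const, card_univ, Fintype.card_fin, nsmul_eq_mul]
    push_cast
    field_simp
  have h1 := (isGreatest_lagrangian (complete (Fin (r + 3)) 3)).2 ⟨_, hmem, rfl⟩
  have h2 : (complete (Fin (r + 3)) 3).lagrangianAt (fun _ => 1 / ((r : ℝ) + 3)) =
      (r + 3).choose 3 * (1 / ((r : ℝ) + 3)) ^ 3 := by
    unfold lagrangianAt complete
    rw [sum_congr rfl fun e he => by rw [prod_const, (mem_powersetCard.1 he).2], sum_const,
      card_powersetCard, card_univ, Fintype.card_fin, nsmul_eq_mul]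
  have h3 : (6 : ℝ) * (r + 3).choose 3 = (r + 3) * (r + 2) * (r + 1) := by
    have := Nat.descFactorial_eq_factorial_mul_choose (r + 3) 3
    simp [Nat.descFactorial, Nat.factorial] at this
    have h4 : ((r + 1) * ((r + 2) * (r + 3)) : ℝ) = 6 * ((r + 3).choose 3) := by
      exact_mod_cast (by linarith : (r + 1) * ((r + 2) * (r + 3)) = 6 * ((r + 3).choose 3))
    linarith
  rw [h2] at h1
  refine le_trans (le_of_eq ?_) (mul_le_mul_of_nonneg_left h1 (by norm_num : (0 : ℝ) ≤ 6))
  rw [← mul_assoc, h3]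
  field_simp

end UniformGraph

theorem corollary1p10 {V : Type*} [Fintype V] (l m : ℕ) (hl₁ : 6 ≤ l) (hl₂ : l ≤ 13)
    (hm₁ : (l - 1).choose 3 ≤ m) (hm₂ : m ≤ (l - 1).choose 3 + (l - 2).choose 2)
    (G : UniformGraph V 3) (hG : G.edges.card = m) (hclique : ¬ G.ContainsClique (l - 1)) :
    G.lagrangian < (UniformGraph.complete (Fin (l - 1)) 3).lagrangian := by
  obtain ⟨r, rfl⟩ : ∃ r, l = r + 4 := ⟨l - 4, by omega⟩
  have h0 := UniformGraph.le_lagrangian_complete r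
  have hne : Nonempty V := by
    have hpos : 0 < G.edges.card := by
      rw [hG]
      exact lt_of_lt_of_le (Nat.choose_pos (by omega)) hm₁
    obtain ⟨e, he⟩ := Finset.card_pos.1 hpos
    obtain ⟨v, -⟩ := Finset.card_pos.1 (by rw [G.card_edge e he]; norm_num : 0 < e.card)
    exact ⟨v⟩
  obtain ⟨x, hx, hxG⟩ := G.isGreatest_lagrangian.1
  have h1 := G.lagrangianAt_lt_of_not_containsClique (r := r) (by omega) (hG ▸ hm₂) hclique hx
  rw [← hxG]
  change _ < (UniformGraph.complete (Fin (r + 3)) 3).lagrangian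
  linarith
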